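/- Let $m\ge 1$ and let $x:\Sigma^m\to\mathbb{R}^{m+1}$ be a complete self-shrinker based at the origin, that is, $\Sigma$ is a connected, complete, smooth $m$-dimensional Riemannian manifold and $x$ is a smooth isometric immersion whose mean curvature vector $\mathbf{H}=\operatorname{tr}\mathbf{A}$ (the trace of the vector-valued second fundamental form $\mathbf{A}$) satisfies $x^{\perp}=-\mathbf{H}$, where $(\cdot)^\perp$ is the projection onto the normal bundle. Assume that $x(\Sigma)$ is bounded, that $|\mathbf{H}|\le\sqrt m$ on $\Sigma$, and that there is a point $x_0\in\Sigma$ with $|x|(x_0)=\sup_\Sigma|x|$. Then $|x|\equiv\sqrt m$ on $\Sigma$, and $x:\Sigma\to\mathbb{S}^m_{\sqrt m}$ is a (surjective) Riemannian covering map onto the round sphere of radius $\sqrt m$ centred at the origin. If moreover $m\ge 2$, then $\Sigma$ is the standard sphere $\mathbb{S}^m_{\sqrt m}$, that is, $x$ is a smooth diffeomorphism, hence a Riemannian isometry, of $\Sigma$ onto $\mathbb{S}^m_{\sqrt m}$. -/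

import Mathlib

open Bundle
open scoped Manifold ContDiff Bundle InnerProductSpace

noncomputable section

namespace Shrinker

section

variable {m : ℕ} {S : Type*} [TopologicalSpace S] [ChartedSpace (EuclideanSpace ℝ (Fin m)) S]

instance finiteDimensional_tangentSpace (p : S) : FiniteDimensional ℝ (TangentSpace (𝓡 m) p) :=
  inferInstanceAs (FiniteDimensional ℝ (EuclideanSpace ℝ (Fin m)))

/-- The normal space at `p` of an immersion `x : S → ℝ^{m+1}`, the orthogonal complement of
`dx_p (T_p S)`. -/
def normalSpace (x : S → EuclideanSpace ℝ (Fin (m + 1))) (p : S) :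
    Submodule ℝ (EuclideanSpace ℝ (Fin (m + 1))) :=
  (mvfderiv (𝓡 m) x p).rangeᗮ

/-- The normal component `u^⊥` at `p` of a vector `u` of `ℝ^{m+1}`. -/
def normalPart (x : S → EuclideanSpace ℝ (Fin (m + 1))) (p : S)
    (u : EuclideanSpace ℝ (Fin (m + 1))) : EuclideanSpace ℝ (Fin (m + 1)) :=
  (normalSpace x p).starProjection u

/-- The second fundamental form `A_p(v, w)`, the normal component of the second derivative of the
immersion, which is read in the preferred chart at `p`; the tangent vectors `v, w ∈ T_p S` are
transported by the differential of this chart. (The normal component does not depend on the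
chart, and equals the Hessian `D dx` with respect to the Levi-Civita connection of the induced
metric.) -/
def secondFundamentalForm (x : S → EuclideanSpace ℝ (Fin (m + 1))) (p : S)
    (v w : TangentSpace (𝓡 m) p) : EuclideanSpace ℝ (Fin (m + 1)) :=
  normalPart x p
    (fderiv ℝ (fderiv ℝ (x ∘ (extChartAt (𝓡 m) p).symm)) (extChartAt (𝓡 m) p p)
      (mvfderiv (𝓡 m) (extChartAt (𝓡 m) p) p v) (mvfderiv (𝓡 m) (extChartAt (𝓡 m) p) p w))

end

section

variable {m : ℕ} {S : Type*} [TopologicalSpace S] [ChartedSpace (EuclideanSpace ℝ (Fin m)) S]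
  [RiemannianBundle (fun p : S ↦ TangentSpace (𝓡 m) p)]

/-- The mean curvature vector `H = tr A`, the trace being taken with respect to the Riemannian
metric of `S` (it is not divided by `m`). -/
def meanCurvature (x : S → EuclideanSpace ℝ (Fin (m + 1))) (p : S) :
    EuclideanSpace ℝ (Fin (m + 1)) :=
  ∑ i, secondFundamentalForm x p (stdOrthonormalBasis ℝ (TangentSpace (𝓡 m) p) i)
    (stdOrthonormalBasis ℝ (TangentSpace (𝓡 m) p) i)

/-- `x : S → ℝ^{m+1}` is a smooth isometric immersion: its differential preserves the Riemannian
inner products (in particular it is injective). -/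
structure IsIsometricImmersion (x : S → EuclideanSpace ℝ (Fin (m + 1))) : Prop where
  contMDiff : ContMDiff (𝓡 m) 𝓘(ℝ, EuclideanSpace ℝ (Fin (m + 1))) ∞ x
  inner_mvfderiv : ∀ (p : S) (v w : TangentSpace (𝓡 m) p),
    ⟪mvfderiv (𝓡 m) x p v, mvfderiv (𝓡 m) x p w⟫_ℝ = ⟪v, w⟫_ℝ

/-- A self-shrinker based at the origin: a connected isometrically immersed hypersurface with
`x^⊥ = -H`. -/
structure IsSelfShrinker (x : S → EuclideanSpace ℝ (Fin (m + 1))) : Prop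
    extends IsIsometricImmersion x where
  connected : ConnectedSpace S
  normalPart_eq : ∀ p : S, normalPart x p (x p) = -meanCurvature x p

end

end Shrinker

end

/-! On a self-shrinker the function `u = |x|²/2` satisfies `Δu - ⟨x^⊤, ∇u⟩ = m - |x|²`. At `x₀` the
gradient of `u` vanishes, so `x = x^⊥ = -H` there, and `|H| ≤ √m` confines the whole image to the
closed ball of radius `√m`. Hence `u` is a subsolution of a drift Laplacian; the equation at its
maximum gives `|x(x₀)|² ≥ m`, and the strong maximum principle makes `u` constant.

No intrinsic Laplacian is needed. `IsSelfShrinker.sum_hessian_le_of_isLocalMax` tests the shrinker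
equation with a function of the ambient space at a local maximum, and
`IsSelfShrinker.isOpen_norm_sq_eq` runs a Hopf-type argument: a Gaussian centred at a nearby image
point of smaller norm is added to `u`, and its maximum over an annulus would contradict that
inequality.

Once `|x| = √m`, the map to the sphere is an immersion between manifolds of equal dimension, hence a
local homeomorphism, and it does not shrink distances locally by more than a constant factor.
Completeness then lifts Lipschitz paths (`exists_lift_of_lipschitzOnWith`), so the inverses of
stereographic charts lift with any prescribed starting point; the lifts are the sheets of a
covering. For `m ≥ 2` the sphere minus two points is connected, so the lifts over two punctured
spheres glue to a global section, and a section of a connected cover is an inverse. -/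

noncomputable section

namespace Shrinker

open Filter Set Topology

/-! ### Second-order conditions at a local maximum -/

section Calculus

variable {E F : Type*} [NormedAddCommGroup E] [NormedSpace ℝ E] [NormedAddCommGroup F]
  [NormedSpace ℝ F]

/-- The second derivative is nonpositive at a local maximum. -/
theorem second_deriv_nonpos_of_isLocalMax {f : E → ℝ} {f' : E → E →L[ℝ] ℝ}
    {f'' : E →L[ℝ] E →L[ℝ] ℝ} {a : E} (h : IsLocalMax f a)
    (hf : ∀ᶠ y in 𝓝 a, HasFDerivAt f (f' y) y) (hf' : HasFDerivAt f' f'' a) (v : E) :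
    f'' v v ≤ 0 := by
  by_contra! hpos
  set c : ℝ → E := fun t ↦ a + t • v with hc
  have hcd : ∀ t, HasDerivAt c v t := fun t ↦ by
    have := ((hasDerivAt_id t).smul_const v).const_add a
    rwa [one_smul] at this
  have hc0 : c 0 = a := by simp [hc]
  have hct : Tendsto c (𝓝 0) (𝓝 a) := by
    have := (hcd 0).continuousAt.tendsto
    rwa [hc0] at this
  have hg : ∀ᶠ t in 𝓝 (0 : ℝ), HasDerivAt (f ∘ c) (f' (c t) v) t := by
    filter_upwards [hct.eventually hf] with t ht using ht.comp_hasDerivAt t (hcd t)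
  have hderiv : deriv (f ∘ c) =ᶠ[𝓝 0] fun t ↦ f' (c t) v := by
    filter_upwards [hg] with t ht using ht.deriv
  have hg' : HasDerivAt (fun t ↦ f' (c t) v) (f'' v v) 0 := by
    have h1 : HasDerivAt (f' ∘ c) (f'' v) 0 :=
      HasFDerivAt.comp_hasDerivAt 0 (by rw [hc0]; exact hf') (hcd 0)
    simpa using h1.clm_apply (hasDerivAt_const (0 : ℝ) v)
  have hdd : deriv (deriv (f ∘ c)) 0 = f'' v v := by
    rw [hderiv.deriv_eq, hg'.deriv]
  have hmax : IsLocalMax (f ∘ c) 0 := by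
    filter_upwards [hct.eventually h] with t ht
    simpa only [Function.comp_apply, hc0] using ht
  -- A positive second derivative makes the maximum a local minimum as well; the function is then
  -- locally constant along the line, and its second derivative is zero.
  have hmin : IsLocalMin (f ∘ c) 0 :=
    isLocalMin_of_deriv_deriv_pos (hdd ▸ hpos) hmax.deriv_eq_zero hg.self_of_nhds.continuousAt
  have hconst : (f ∘ c) =ᶠ[𝓝 0] fun _ ↦ (f ∘ c) 0 := by
    filter_upwards [hmax, hmin] with t h1 h2 using le_antisymm h1 h2
  have : deriv (deriv (f ∘ c)) 0 = 0 := by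
    rw [hconst.deriv.deriv_eq]; simp
  linarith

/-- At a local maximum of a composition `w ∘ X`, the two terms of its Hessian add up to a
nonpositive quantity. -/
theorem second_deriv_comp_nonpos_of_isLocalMax {w : F → ℝ} {w' : F → F →L[ℝ] ℝ}
    {w'' : F →L[ℝ] F →L[ℝ] ℝ} {X : E → F} {a : E} (hX : ContDiffAt ℝ 2 X a)
    (hw : ∀ y, HasFDerivAt w (w' y) y) (hw' : HasFDerivAt w' w'' (X a))
    (h : IsLocalMax (w ∘ X) a) :
    (∀ v, w' (X a) (fderiv ℝ X a v) = 0) ∧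
      ∀ v, w'' (fderiv ℝ X a v) (fderiv ℝ X a v) +
        w' (X a) (fderiv ℝ (fderiv ℝ X) a v v) ≤ 0 := by
  have hXd : ∀ᶠ y in 𝓝 a, HasFDerivAt X (fderiv ℝ X y) y := by
    filter_upwards [hX.eventually (by simp)] with y hy
      using (hy.differentiableAt (by simp)).hasFDerivAt
  have hX' : HasFDerivAt (fderiv ℝ X) (fderiv ℝ (fderiv ℝ X) a) a :=
    ((hX.fderiv_right (m := 1) (by norm_num)).differentiableAt (by simp)).hasFDerivAt
  have hf : ∀ᶠ y in 𝓝 a, HasFDerivAt (w ∘ X) ((w' (X y)).comp (fderiv ℝ X y)) y := by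
    filter_upwards [hXd] with y hy using (hw _).comp y hy
  have hf' := (hw'.comp a hXd.self_of_nhds).clm_comp hX'
  refine ⟨fun v ↦ ?_, fun v ↦ ?_⟩
  · have := h.hasFDerivAt_eq_zero hf.self_of_nhds
    simpa using congr($this v)
  · have := second_deriv_nonpos_of_isLocalMax h hf hf' v
    simpa [add_comm] using this

end Calculus

/-! ### The shrinker equation tested at a local maximum -/

section KeyInequality

variable {m : ℕ} {S : Type*} [TopologicalSpace S] [ChartedSpace (EuclideanSpace ℝ (Fin m)) S]
  [IsManifold (𝓡 m) ∞ S]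

theorem contDiffAt_comp_extChartAt_symm {F : Type*} [NormedAddCommGroup F] [NormedSpace ℝ F]
    {x : S → F} (hx : ContMDiff (𝓡 m) 𝓘(ℝ, F) ∞ x) (p : S) {y : EuclideanSpace ℝ (Fin m)}
    (hy : y ∈ (extChartAt (𝓡 m) p).target) :
    ContDiffAt ℝ ∞ (x ∘ (extChartAt (𝓡 m) p).symm) y := by
  have h1 : ContMDiffAt 𝓘(ℝ, EuclideanSpace ℝ (Fin m)) (𝓡 m) ∞ (extChartAt (𝓡 m) p).symm y :=
    (contMDiffOn_extChartAt_symm p y hy).contMDiffAt ((isOpen_extChartAt_target p).mem_nhds hy)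
  exact contMDiffAt_iff_contDiffAt.1 ((hx _).comp y h1)

/-- The derivative of `x` read in a chart, in terms of the differential of `x`. -/
theorem fderiv_comp_extChartAt_symm {F : Type*} [NormedAddCommGroup F] [NormedSpace ℝ F]
    {x : S → F} (hx : ContMDiff (𝓡 m) 𝓘(ℝ, F) ∞ x) (p : S) {y : EuclideanSpace ℝ (Fin m)}
    (hy : y ∈ (extChartAt (𝓡 m) p).target) (v : EuclideanSpace ℝ (Fin m)) :
    fderiv ℝ (x ∘ (extChartAt (𝓡 m) p).symm) y v =
      mvfderiv (𝓡 m) x ((extChartAt (𝓡 m) p).symm y)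
        (mfderiv 𝓘(ℝ, EuclideanSpace ℝ (Fin m)) (𝓡 m) (extChartAt (𝓡 m) p).symm y v) := by
  have h1 : ContMDiffAt 𝓘(ℝ, EuclideanSpace ℝ (Fin m)) (𝓡 m) ∞ (extChartAt (𝓡 m) p).symm y :=
    (contMDiffOn_extChartAt_symm p y hy).contMDiffAt ((isOpen_extChartAt_target p).mem_nhds hy)
  have h := mfderiv_comp y ((hx ((extChartAt (𝓡 m) p).symm y)).mdifferentiableAt (by simp))
    (h1.mdifferentiableAt (by simp))
  rw [mfderiv_eq_fderiv] at h
  exact congr($h v)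

/-- The differential of `x`, in terms of the derivative of `x` read in the chart. -/
theorem mvfderiv_eq_fderiv_comp_extChartAt_symm {F : Type*} [NormedAddCommGroup F]
    [NormedSpace ℝ F] {x : S → F} (hx : ContMDiff (𝓡 m) 𝓘(ℝ, F) ∞ x) (p : S)
    (v : TangentSpace (𝓡 m) p) :
    mvfderiv (𝓡 m) x p v = fderiv ℝ (x ∘ (extChartAt (𝓡 m) p).symm) (extChartAt (𝓡 m) p p)
      (mvfderiv (𝓡 m) (extChartAt (𝓡 m) p) p v) := by
  have h1 : MDifferentiableAt (𝓡 m) 𝓘(ℝ, EuclideanSpace ℝ (Fin m)) (extChartAt (𝓡 m) p) p :=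
    (contMDiffAt_extChartAt (n := ∞)).mdifferentiableAt (by simp)
  have h2 := (contDiffAt_comp_extChartAt_symm hx p (mem_extChartAt_target p)).differentiableAt
    (by simp)
  have heq : x =ᶠ[𝓝 p] (x ∘ (extChartAt (𝓡 m) p).symm) ∘ extChartAt (𝓡 m) p := by
    filter_upwards [extChartAt_source_mem_nhds (I := 𝓡 m) p] with q hq
    rw [Function.comp_apply, Function.comp_apply, (extChartAt (𝓡 m) p).left_inv hq]
  have h := mfderiv_comp p h2.mdifferentiableAt h1
  rw [mfderiv_eq_fderiv, ← heq.mfderiv_eq] at h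
  exact congr($h v)

variable [RiemannianBundle (fun p : S ↦ TangentSpace (𝓡 m) p)]

/-- The maximum principle for the composition of a self-shrinker with a function of the ambient
space: the trace of the ambient Hessian on the tangent space is at most the radial derivative. -/
theorem IsSelfShrinker.sum_hessian_le_of_isLocalMax
    {x : S → EuclideanSpace ℝ (Fin (m + 1))} (hx : IsSelfShrinker x) {p : S}
    {w : EuclideanSpace ℝ (Fin (m + 1)) → ℝ}
    {w' : EuclideanSpace ℝ (Fin (m + 1)) → EuclideanSpace ℝ (Fin (m + 1)) →L[ℝ] ℝ}
    {w'' : EuclideanSpace ℝ (Fin (m + 1)) →L[ℝ] EuclideanSpace ℝ (Fin (m + 1)) →L[ℝ] ℝ}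
    (hw : ∀ y, HasFDerivAt w (w' y) y) (hw' : HasFDerivAt w' w'' (x p))
    (h : IsLocalMax (w ∘ x) p) :
    (∀ v, w' (x p) (mvfderiv (𝓡 m) x p v) = 0) ∧
      ∑ i, w'' (mvfderiv (𝓡 m) x p (stdOrthonormalBasis ℝ (TangentSpace (𝓡 m) p) i))
        (mvfderiv (𝓡 m) x p (stdOrthonormalBasis ℝ (TangentSpace (𝓡 m) p) i)) ≤
      w' (x p) (x p) := by
  set φ := extChartAt (𝓡 m) p with hφ
  have hinv : φ.symm (φ p) = p := extChartAt_to_inv p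
  have hXp : (x ∘ φ.symm) (φ p) = x p := by simp [hinv]
  have hX : ContDiffAt ℝ 2 (x ∘ φ.symm) (φ p) :=
    (contDiffAt_comp_extChartAt_symm hx.contMDiff p (mem_extChartAt_target p)).of_le
      (WithTop.coe_le_coe.2 le_top)
  have hmax : IsLocalMax (w ∘ (x ∘ φ.symm)) (φ p) := by
    have h1 : Tendsto φ.symm (𝓝 (φ p)) (𝓝 p) := by
      simpa only [hφ, extChartAt_to_inv] using
        (continuousAt_extChartAt_symm (I := 𝓡 m) p).tendsto
    filter_upwards [h1.eventually h] with y hy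
    simpa only [Function.comp_apply, hinv] using hy
  obtain ⟨hd, hdd⟩ := second_deriv_comp_nonpos_of_isLocalMax hX hw (by rwa [hXp]) hmax
  rw [hXp] at hd hdd
  have hdx : ∀ v, w' (x p) (mvfderiv (𝓡 m) x p v) = 0 := fun v ↦ by
    rw [mvfderiv_eq_fderiv_comp_extChartAt_symm hx.contMDiff p v]; exact hd _
  refine ⟨hdx, ?_⟩
  -- The first-order condition says that `w' (x p)` kills tangent vectors, so normal projections are
  -- invisible to it. This turns the chart's raw second derivative into the second fundamental form
  -- and `x^⊥` into `x`.
  have hnormal : ∀ u, w' (x p) (normalPart x p u) = w' (x p) u := by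
    intro u
    have hmem : u - normalPart x p u ∈ (mvfderiv (𝓡 m) x p).range := by
      have := (normalSpace x p).sub_starProjection_mem_orthogonal u
      rwa [normalSpace, Submodule.orthogonal_orthogonal] at this
    obtain ⟨v, hv⟩ := hmem
    have h0 : w' (x p) (u - normalPart x p u) = 0 := by rw [← hv]; exact hdx v
    rw [map_sub] at h0
    linarith
  have hH : w' (x p) (x p) = -w' (x p) (meanCurvature x p) := by
    rw [← hnormal (x p), hx.normalPart_eq p, map_neg]
  rw [hH, meanCurvature, map_sum, ← Finset.sum_neg_distrib]
  refine Finset.sum_le_sum fun i _ ↦ ?_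
  rw [secondFundamentalForm, hnormal, mvfderiv_eq_fderiv_comp_extChartAt_symm hx.contMDiff p]
  linarith [hdd (mvfderiv (𝓡 m) φ p (stdOrthonormalBasis ℝ (TangentSpace (𝓡 m) p) i))]

end KeyInequality

/-! ### Secants of an immersion compared with tangent vectors -/

section Secants

/-- Near a point where its derivative is injective, a `C¹` map expands distances, and its secants
are close to the corresponding tangent vectors. -/
theorem exists_closedBall_secant_estimates {E F : Type*} [NormedAddCommGroup E] [NormedSpace ℝ E]
    [FiniteDimensional ℝ E] [NormedAddCommGroup F] [NormedSpace ℝ F] {X : E → F} {a : E}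
    (hX : ContDiffAt ℝ 1 X a) (hinj : Function.Injective (fderiv ℝ X a)) {U : Set E}
    (hU : U ∈ 𝓝 a) :
    ∃ c > 0, ∃ R > 0, Metric.closedBall a R ⊆ U ∧
      ∀ y ∈ Metric.closedBall a R, ∀ y' ∈ Metric.closedBall a R,
        c * ‖y - y'‖ ≤ ‖X y - X y'‖ ∧
        ∀ z ∈ Metric.closedBall a R,
          ‖X y - X y' - fderiv ℝ X z (y - y')‖ ≤ 1 / 4 * ‖X y - X y'‖ := by
  obtain ⟨K, hK, hlip⟩ :=
    (fderiv ℝ X a).toLinearMap.injective_iff_antilipschitz.1 hinj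
  set c : ℝ := (K : ℝ)⁻¹ with hc
  have hKpos : (0 : ℝ) < K := hK
  have hcpos : 0 < c := inv_pos.2 hKpos
  have hbelow : ∀ v, c * ‖v‖ ≤ ‖fderiv ℝ X a v‖ := fun v ↦ by
    have := hlip.le_mul_norm (map_zero _) v
    rw [hc, inv_mul_le_iff₀ hKpos]
    exact this
  have hstrict := hX.hasStrictFDerivAt (by simp)
  -- Two errors of `c / 9`, from linearization and from moving the base point, total `2c/9`; secants
  -- keep length at least `8c/9` times `‖y - y'‖`. The quotient is the required `1 / 4`.
  have h1 := hstrict.isLittleO.def (show (0 : ℝ) < c / 9 by positivity)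
  have hcont : ContinuousAt (fderiv ℝ X) a :=
    (hX.fderiv_right (m := 0) (by norm_num)).continuousAt
  have h2 : ∀ᶠ z in 𝓝 a, ‖fderiv ℝ X z - fderiv ℝ X a‖ < c / 9 := by
    have := hcont.eventually (Metric.ball_mem_nhds _ (show (0 : ℝ) < c / 9 by positivity))
    simpa only [Metric.mem_ball, dist_eq_norm] using this
  rw [nhds_prod_eq, eventually_prod_self_iff'] at h1
  obtain ⟨V, hV, h1⟩ := h1
  obtain ⟨R, hR, hRs⟩ := Metric.nhds_basis_closedBall.mem_iff.1 (inter_mem (inter_mem hU hV) h2)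
  refine ⟨c / 2, by positivity, R, hR, fun y hy ↦ (hRs hy).1.1, fun y hy y' hy' ↦ ?_⟩
  have e1 := h1 y (hRs hy).1.2 y' (hRs hy').1.2
  simp only at e1
  have e2 : 8 / 9 * c * ‖y - y'‖ ≤ ‖X y - X y'‖ := by
    have := norm_sub_norm_le (fderiv ℝ X a (y - y')) (X y - X y')
    rw [norm_sub_rev (fderiv ℝ X a (y - y'))] at this
    linarith [hbelow (y - y')]
  refine ⟨?_, fun z hz ↦ ?_⟩
  · have : 0 ≤ c * ‖y - y'‖ := by positivity
    linarith
  · have e3 : ‖fderiv ℝ X z (y - y') - fderiv ℝ X a (y - y')‖ ≤ c / 9 * ‖y - y'‖ := by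
      rw [← sub_apply]
      refine (ContinuousLinearMap.le_opNorm _ _).trans ?_
      gcongr
      exact (hRs hz).2.le
    have e4 := norm_sub_le_norm_sub_add_norm_sub (X y - X y') (fderiv ℝ X a (y - y'))
      (fderiv ℝ X z (y - y'))
    rw [norm_sub_rev (fderiv ℝ X a (y - y'))] at e4
    linarith

/-- A vector close to the range of a linear isometry has a large component along this range. -/
theorem le_sum_sq_inner_of_norm_sub_le {ι T F : Type*} [Fintype ι] [NormedAddCommGroup T]
    [InnerProductSpace ℝ T] [NormedAddCommGroup F] [InnerProductSpace ℝ F]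
    (b : OrthonormalBasis ι ℝ T) {L : T →ₗ[ℝ] F} (hL : ∀ v, ‖L v‖ = ‖v‖) {d : F} {v : T}
    (h : ‖d - L v‖ ≤ 1 / 4 * ‖d‖) : 1 / 4 * ‖d‖ ^ 2 ≤ ∑ i, ⟪d, L (b i)⟫_ℝ ^ 2 := by
  have h1 : ⟪d, L v⟫_ℝ = ∑ i, ⟪b i, v⟫_ℝ * ⟪d, L (b i)⟫_ℝ := by
    conv_lhs => rw [← b.sum_repr' v]
    simp [map_sum, inner_sum, inner_smul_right]
  have h2 := Finset.sum_mul_sq_le_sq_mul_sq Finset.univ (fun i ↦ ⟪b i, v⟫_ℝ)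
    (fun i ↦ ⟪d, L (b i)⟫_ℝ)
  have h3 : ∑ i, ⟪b i, v⟫_ℝ ^ 2 = ‖v‖ ^ 2 := by
    simpa using b.sum_sq_norm_inner_right v
  rw [← h1, h3] at h2
  have h4 : 3 / 4 * ‖d‖ ^ 2 ≤ ⟪d, L v⟫_ℝ := by
    have e : ⟪d, L v⟫_ℝ = ‖d‖ ^ 2 - ⟪d, d - L v⟫_ℝ := by
      rw [inner_sub_right, real_inner_self_eq_norm_sq]; ring
    have e' := real_inner_le_norm d (d - L v)
    nlinarith [norm_nonneg d, mul_le_mul_of_nonneg_left h (norm_nonneg d)]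
  have h5 : ‖v‖ ≤ 5 / 4 * ‖d‖ := by
    have := norm_le_norm_add_norm_sub' (L v) d
    rw [norm_sub_rev, hL] at this
    linarith
  set A := ∑ i, ⟪d, L (b i)⟫_ℝ ^ 2
  have hA : 0 ≤ A := Finset.sum_nonneg fun _ _ ↦ sq_nonneg _
  rcases (norm_nonneg d).eq_or_lt with h0 | h0
  · rw [← h0]; simpa using hA
  -- Cauchy–Schwarz with `⟪d, L v⟫ ≥ 3/4 ‖d‖²` and `‖v‖ ≤ 5/4 ‖d‖` yields `A ≥ 9/25 ‖d‖²`, which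
  -- exceeds the stated quarter.
  · have h6 : (3 / 4 * ‖d‖ ^ 2) ^ 2 ≤ (5 / 4 * ‖d‖) ^ 2 * A :=
      (pow_le_pow_left₀ (by positivity) h4 2).trans <| h2.trans <| by gcongr
    have h7 : ‖d‖ ^ 2 * (9 / 25 * ‖d‖ ^ 2) ≤ ‖d‖ ^ 2 * A := by nlinarith
    have h8 := le_of_mul_le_mul_left h7 (by positivity)
    nlinarith [sq_nonneg ‖d‖]

end Secants

/-! ### The Gaussian barrier and its derivatives -/

section Barrier

variable {F : Type*} [NormedAddCommGroup F] [InnerProductSpace ℝ F]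

variable (F) in
/-- The real inner product, as a continuous bilinear map. -/
def realInner : F →L[ℝ] F →L[ℝ] ℝ := innerSL ℝ

@[simp]
theorem realInner_apply (v w : F) : realInner F v w = ⟪v, w⟫_ℝ := rfl

/-- Half the squared norm, perturbed by a Gaussian centred at `c`. -/
def barrier (ε α κ : ℝ) (c : F) (y : F) : ℝ :=
  1 / 2 * ‖y‖ ^ 2 + ε * (Real.exp (-α * ‖y - c‖ ^ 2) - κ)

/-- The derivative of `barrier`. -/
def barrierDeriv (ε α : ℝ) (c : F) (y : F) : F →L[ℝ] ℝ :=
  realInner F y + (-2 * α * ε * Real.exp (-α * ‖y - c‖ ^ 2)) • realInner F (y - c)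

/-- The Hessian of `barrier`. -/
def barrierHessian (ε α : ℝ) (c : F) (y : F) : F →L[ℝ] F →L[ℝ] ℝ :=
  realInner F + ((-2 * α * ε * Real.exp (-α * ‖y - c‖ ^ 2)) • realInner F +
    ((4 * α ^ 2 * ε * Real.exp (-α * ‖y - c‖ ^ 2)) • realInner F (y - c)).smulRight
      (realInner F (y - c)))

theorem hasFDerivAt_exp_neg_mul_norm_sub_sq (α : ℝ) (c y : F) :
    HasFDerivAt (fun y : F ↦ Real.exp (-α * ‖y - c‖ ^ 2))
      ((-2 * α * Real.exp (-α * ‖y - c‖ ^ 2)) • realInner F (y - c)) y := by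
  have h := ((((hasFDerivAt_id y).sub_const c).norm_sq).const_mul (-α)).exp
  refine h.congr_fderiv ?_
  ext v
  simp
  ring

theorem hasFDerivAt_barrier (ε α κ : ℝ) (c y : F) :
    HasFDerivAt (barrier ε α κ c) (barrierDeriv ε α c y) y := by
  have h := (((hasFDerivAt_id y).norm_sq).const_mul (1 / 2)).add
    (((hasFDerivAt_exp_neg_mul_norm_sub_sq α c y).sub_const κ).const_mul ε)
  refine h.congr_fderiv ?_
  ext v
  simp [barrierDeriv]
  ring

theorem hasFDerivAt_barrierDeriv (ε α : ℝ) (c y : F) :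
    HasFDerivAt (barrierDeriv ε α c) (barrierHessian ε α c y) y := by
  have h := ((realInner F).hasFDerivAt (x := y)).add
    (((hasFDerivAt_exp_neg_mul_norm_sub_sq α c y).const_mul (-2 * α * ε)).smul
      (((realInner F).hasFDerivAt (x := y - c)).comp y ((hasFDerivAt_id y).sub_const c)))
  refine h.congr_fderiv ?_
  ext v u
  simp [barrierHessian, -mul_eq_mul_right_iff]
  ring

end Barrier

/-! ### The strong maximum principle for `|x|²` -/

section StrongMaximumPrinciple

variable {m : ℕ} {S : Type*} [TopologicalSpace S] [ChartedSpace (EuclideanSpace ℝ (Fin m)) S]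

theorem finrank_tangentSpace (p : S) : Module.finrank ℝ (TangentSpace (𝓡 m) p) = m :=
  finrank_euclideanSpace_fin

variable [RiemannianBundle (fun p : S ↦ TangentSpace (𝓡 m) p)]
  {x : S → EuclideanSpace ℝ (Fin (m + 1))}

theorem IsIsometricImmersion.norm_mvfderiv (hx : IsIsometricImmersion x) (p : S)
    (v : TangentSpace (𝓡 m) p) : ‖mvfderiv (𝓡 m) x p v‖ = ‖v‖ := by
  rw [norm_eq_sqrt_real_inner, norm_eq_sqrt_real_inner, hx.inner_mvfderiv]

theorem IsIsometricImmersion.injective_mvfderiv (hx : IsIsometricImmersion x) (p : S) :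
    Function.Injective (mvfderiv (𝓡 m) x p) := by
  refine (injective_iff_map_eq_zero _).2 fun v hv ↦ ?_
  rw [← norm_eq_zero, ← hx.norm_mvfderiv p v, hv, norm_zero]

variable [IsManifold (𝓡 m) ∞ S]

/-- The injective `dx` factors through the differential of the chart, which is therefore injective,
and onto by equality of dimensions; injectivity passes to the other factor. -/
theorem IsIsometricImmersion.injective_fderiv_comp_extChartAt_symm
    (hx : IsIsometricImmersion x) (p : S) :
    Function.Injective (fderiv ℝ (x ∘ (extChartAt (𝓡 m) p).symm) (extChartAt (𝓡 m) p p)) := by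
  set L : TangentSpace (𝓡 m) p →ₗ[ℝ] EuclideanSpace ℝ (Fin m) :=
    (mvfderiv (𝓡 m) (extChartAt (𝓡 m) p) p).toLinearMap with hL
  have hdx : ∀ v : TangentSpace (𝓡 m) p, mvfderiv (𝓡 m) x p v =
      fderiv ℝ (x ∘ (extChartAt (𝓡 m) p).symm) (extChartAt (𝓡 m) p p) (L v) :=
    mvfderiv_eq_fderiv_comp_extChartAt_symm hx.contMDiff p
  have hLinj : Function.Injective L := fun v w hvw ↦
    hx.injective_mvfderiv p (by rw [hdx, hdx]; exact congrArg _ hvw)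
  refine (injective_iff_map_eq_zero _).2 fun u hu ↦ ?_
  obtain ⟨v, rfl⟩ := (LinearMap.injective_iff_surjective_of_finrank_eq_finrank
    ((finrank_tangentSpace p).trans finrank_euclideanSpace_fin.symm)).1 hLinj u
  rw [← hdx] at hu
  have hv : v = 0 := hx.injective_mvfderiv p (hu.trans (map_zero _).symm)
  rw [hv, map_zero]

/-- The trace of the barrier's Hessian over an orthonormal tangent frame contributes `m` from the
squared norm and, from the Gaussian, a term quadratic in `α` that sees only the tangential part of
`x p - c`. That term must dominate for large `α`. -/
theorem IsSelfShrinker.le_of_isLocalMax_barrier (hx : IsSelfShrinker x) {p : S} {ε α κ : ℝ}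
    {c : EuclideanSpace ℝ (Fin (m + 1))} (h : IsLocalMax (barrier ε α κ c ∘ x) p) :
    m + 2 * α * ε * Real.exp (-α * ‖x p - c‖ ^ 2) *
        (2 * α * ∑ i, ⟪x p - c, mvfderiv (𝓡 m) x p
          (stdOrthonormalBasis ℝ (TangentSpace (𝓡 m) p) i)⟫_ℝ ^ 2 - m + ⟪x p - c, x p⟫_ℝ) ≤
      ‖x p‖ ^ 2 := by
  have key := (hx.sum_hessian_le_of_isLocalMax (hasFDerivAt_barrier ε α κ c)
    (hasFDerivAt_barrierDeriv ε α c (x p)) h).2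
  have hone : ∀ i, ‖mvfderiv (𝓡 m) x p (stdOrthonormalBasis ℝ (TangentSpace (𝓡 m) p) i)‖ = 1 :=
    fun i ↦ by rw [hx.toIsIsometricImmersion.norm_mvfderiv]; simp
  simp only [barrierHessian, barrierDeriv, add_apply, smul_apply, realInner_apply,
    real_inner_self_eq_norm_sq, hone, ContinuousLinearMap.smulRight_apply, smul_eq_mul,
    Finset.sum_add_distrib, Finset.sum_const, Finset.card_univ, Fintype.card_fin,
    finrank_tangentSpace, nsmul_eq_mul] at key
  have hsum : ∀ k : ℝ, ∑ i, k * ⟪x p - c, mvfderiv (𝓡 m) x p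
      (stdOrthonormalBasis ℝ (TangentSpace (𝓡 m) p) i)⟫_ℝ * ⟪x p - c, mvfderiv (𝓡 m) x p
      (stdOrthonormalBasis ℝ (TangentSpace (𝓡 m) p) i)⟫_ℝ = k * ∑ i, ⟪x p - c, mvfderiv (𝓡 m) x p
      (stdOrthonormalBasis ℝ (TangentSpace (𝓡 m) p) i)⟫_ℝ ^ 2 := fun k ↦ by
    rw [Finset.mul_sum]; exact Finset.sum_congr rfl fun i _ ↦ by ring
  rw [hsum] at key
  linarith

/-- If `α` is large, the barrier has no interior local maximum away from its centre. -/
theorem IsSelfShrinker.not_isLocalMax_barrier (hx : IsSelfShrinker x)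
    (hle : ∀ p, ‖x p‖ ^ 2 ≤ m) {p q : S} {ε α κ δ : ℝ} (hε : 0 < ε) (hδ : 0 < δ)
    (hα : 6 * m / δ ^ 2 < α) (hpq : δ ≤ ‖x p - x q‖) {v : TangentSpace (𝓡 m) p}
    (hv : ‖x p - x q - mvfderiv (𝓡 m) x p v‖ ≤ 1 / 4 * ‖x p - x q‖) :
    ¬ IsLocalMax (barrier ε α κ (x q) ∘ x) p := by
  intro hmax
  have key := hx.le_of_isLocalMax_barrier hmax
  have hsum := le_sum_sq_inner_of_norm_sub_le (stdOrthonormalBasis ℝ (TangentSpace (𝓡 m) p))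
    (L := (mvfderiv (𝓡 m) x p).toLinearMap)
    (hx.toIsIsometricImmersion.norm_mvfderiv p) hv
  simp only [ContinuousLinearMap.coe_coe] at hsum
  set A := ∑ i, ⟪x p - x q, mvfderiv (𝓡 m) x p
    (stdOrthonormalBasis ℝ (TangentSpace (𝓡 m) p) i)⟫_ℝ ^ 2 with hA
  have hαpos : 0 < α := lt_of_le_of_lt (by positivity) hα
  -- The bracket in `key` is `2αA - m + ⟪x p - x q, x p⟫`, whose last term is at least `-2m` in the
  -- ball; exceeding `3m` makes it positive, which is incompatible with `‖x p‖² ≤ m`.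
  have h1 : 3 * m < 2 * α * A := by
    have h2 : 6 * m < α * δ ^ 2 := (div_lt_iff₀ (by positivity)).1 hα
    have h3 : δ ^ 2 ≤ 4 * A := by linarith [pow_le_pow_left₀ hδ.le hpq 2]
    linarith [mul_le_mul_of_nonneg_left h3 hαpos.le]
  have h2 : -(2 * m) ≤ ⟪x p - x q, x p⟫_ℝ := by
    rw [inner_sub_left, real_inner_self_eq_norm_sq]
    linarith [real_inner_le_norm (x q) (x p), hle p, hle q, sq_nonneg ‖x p‖,
      two_mul_le_add_sq ‖x q‖ ‖x p‖]
  have h3 : 0 < 2 * α * ε * Real.exp (-α * ‖x p - x q‖ ^ 2) *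
      (2 * α * A - m + ⟪x p - x q, x p⟫_ℝ) := by
    have : 0 < 2 * α * A - m + ⟪x p - x q, x p⟫_ℝ := by linarith
    positivity
  linarith [hle p]

/-- A self-shrinker inside the ball of radius `√m` touches its boundary in an open set. -/
theorem IsSelfShrinker.isOpen_norm_sq_eq (hx : IsSelfShrinker x)
    (hle : ∀ p, ‖x p‖ ^ 2 ≤ m) : IsOpen {p | ‖x p‖ ^ 2 = m} := by
  rw [isOpen_iff_mem_nhds]
  intro p₀ hp₀
  set φ := extChartAt (𝓡 m) p₀ with hφ
  set X := x ∘ φ.symm with hXdef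
  set a := φ p₀ with ha
  have hXle : ∀ y, ‖X y‖ ^ 2 ≤ m := fun y ↦ hle _
  have hXs : ∀ y ∈ φ.target, ContDiffAt ℝ ∞ X y := fun y hy ↦
    contDiffAt_comp_extChartAt_symm hx.contMDiff p₀ hy
  have haT : a ∈ φ.target := mem_extChartAt_target p₀
  have hXa : X a = x p₀ := by simp only [hXdef, Function.comp_apply, ha, hφ, extChartAt_to_inv]
  have hinj : Function.Injective (fderiv ℝ X a) :=
    hx.toIsIsometricImmersion.injective_fderiv_comp_extChartAt_symm p₀
  obtain ⟨c, hc, R, hR, hRT, hest⟩ := exists_closedBall_secant_estimates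
    ((hXs a haT).of_le (WithTop.coe_le_coe.2 le_top)) hinj (extChartAt_target_mem_nhds p₀)
  have hXcont : ContinuousOn X (Metric.closedBall a R) := fun y hy ↦
    (hXs y (hRT hy)).continuousAt.continuousWithinAt
  -- Points on the outer sphere `‖y - a‖ = R` are at least `R / 2` from any `q` near `a`, so their
  -- images are at least `s` from `X q`, while `X a` is closer than `s`.
  set s := c * (R / 2) with hs
  have hspos : 0 < s := by positivity
  have hnear : ∀ᶠ y in 𝓝 a, ‖X y - X a‖ < s ∧ ‖y - a‖ < R / 2 := by
    have h1 := (hXs a haT).continuousAt.eventually (Metric.ball_mem_nhds _ hspos)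
    have h2 := Metric.ball_mem_nhds a (half_pos hR)
    filter_upwards [h1, h2] with y hy1 hy2
    rw [Metric.mem_ball, dist_eq_norm] at hy2
    rw [dist_eq_norm] at hy1
    exact ⟨hy1, hy2⟩
  filter_upwards [(continuousAt_extChartAt (I := 𝓡 m) p₀).eventually hnear,
    extChartAt_source_mem_nhds (I := 𝓡 m) p₀] with q₀ hq hqs
  by_contra hne
  set q := φ q₀ with hqdef
  have hXq : X q = x q₀ := by
    simp only [hXdef, Function.comp_apply, hqdef, φ.left_inv hqs]
  have hlt : ‖X q‖ ^ 2 < m := lt_of_le_of_ne (hXle q) (by rw [hXq]; exact hne)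
  have hqR : q ∈ Metric.closedBall a R := by
    rw [Metric.mem_closedBall, dist_eq_norm]; linarith [hq.2]
  -- Near `q`, continuity gives `‖X y‖² / 2 < m / 2 - ε`; as the Gaussian is at most `1`, the
  -- perturbation cannot lift the barrier above `m / 2` there.
  set ε := (m - ‖X q‖ ^ 2) / 4 with hε
  have hεpos : 0 < ε := by rw [hε]; linarith
  have hqa : 0 < ‖a - q‖ := by
    rw [norm_pos_iff, sub_ne_zero]
    rintro haq
    rw [← haq, hXa] at hlt
    exact hlt.ne hp₀
  obtain ⟨ρ, hρ, hρlt, hρs⟩ : ∃ ρ > 0, ρ < ‖a - q‖ ∧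
      ∀ y, ‖y - q‖ ≤ ρ → ‖X y‖ ^ 2 < m - 2 * ε := by
    have hcq : ∀ᶠ y in 𝓝 q, ‖X y‖ ^ 2 < m - 2 * ε :=
      ((hXs q (hRT hqR)).continuousAt.norm.pow 2).eventually_lt continuousAt_const
        (show ‖X q‖ ^ 2 < m - 2 * ε by rw [hε]; linarith)
    obtain ⟨r, hr, hrs⟩ := Metric.nhds_basis_closedBall.mem_iff.1 hcq
    refine ⟨min r (‖a - q‖ / 2), by positivity, (min_le_right _ _).trans_lt (by linarith),
      fun y hy ↦ hrs ?_⟩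
    rw [Metric.mem_closedBall, dist_eq_norm]
    exact hy.trans (min_le_left _ _)
  -- This is the threshold of `not_isLocalMax_barrier` with `δ = c * ρ`, a lower bound for `‖X y - X
  -- q‖` outside the inner ball; the `+ 1` makes it strict.
  set α := 6 * m / (c * ρ) ^ 2 + 1 with hα
  have hαpos : 0 < α := by positivity
  -- With this normalization the perturbation is positive at `a` and nonpositive on the outer
  -- sphere. So the barrier exceeds `m / 2` at `a` but on neither boundary of the annulus, and its
  -- maximum is interior.
  set κ := Real.exp (-α * s ^ 2) with hκ
  set w := barrier ε α κ (X q) with hw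
  set K := Metric.closedBall a R \ Metric.ball q ρ with hK
  have haK : a ∈ K := by
    refine ⟨Metric.mem_closedBall_self hR.le, ?_⟩
    rw [Metric.mem_ball, dist_eq_norm, not_lt]
    exact hρlt.le
  have hwcont : Continuous w := continuous_iff_continuousAt.2 fun y ↦
    (hasFDerivAt_barrier ε α κ (X q) y).continuousAt
  obtain ⟨y, hyK, hymax⟩ := ((isCompact_closedBall a R).diff Metric.isOpen_ball).exists_isMaxOn
    ⟨a, haK⟩ (hwcont.comp_continuousOn (hXcont.mono sdiff_subset))
  have hwa : m / 2 < w (X a) := by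
    have h1 : κ < Real.exp (-α * ‖X a - X q‖ ^ 2) := by
      rw [hκ, Real.exp_lt_exp, norm_sub_rev]
      have : ‖X q - X a‖ ^ 2 < s ^ 2 := pow_lt_pow_left₀ hq.1 (norm_nonneg _) two_ne_zero
      nlinarith
    have h2 : ‖X a‖ ^ 2 = m := by rw [hXa]; exact hp₀
    have h3 := mul_pos hεpos (sub_pos.2 h1)
    simp only [hw, barrier, h2]
    linarith
  have hwy : m / 2 < w (X y) := hwa.trans_le (hymax haK)
  have hyρ : ρ < ‖y - q‖ := by
    by_contra! hcon
    have h1 := hρs y hcon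
    have h2 : Real.exp (-α * ‖X y - X q‖ ^ 2) ≤ 1 := by
      rw [Real.exp_le_one_iff]
      nlinarith [sq_nonneg ‖X y - X q‖]
    have h3 : 0 < κ := Real.exp_pos _
    have h4 : ε * (Real.exp (-α * ‖X y - X q‖ ^ 2) - κ) ≤ ε * 1 := by
      gcongr; linarith
    simp only [hw, barrier] at hwy
    linarith
  have hyc := (hest y hyK.1 q hqR).1
  have hyR : ‖y - a‖ < R := by
    by_contra! hcon
    have h1 : R / 2 ≤ ‖y - q‖ := by
      have := norm_sub_le_norm_sub_add_norm_sub y q a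
      linarith [hq.2]
    have h2 : s ≤ ‖X y - X q‖ := le_trans (by rw [hs]; gcongr) hyc
    have h3 : Real.exp (-α * ‖X y - X q‖ ^ 2) ≤ κ := by
      rw [hκ, Real.exp_le_exp]
      have := pow_le_pow_left₀ hspos.le h2 2
      nlinarith
    have h4 := mul_nonneg hεpos.le (sub_nonneg.2 h3)
    simp only [hw, barrier] at hwy
    linarith [hXle y]
  have hmaxX : ∀ᶠ z in 𝓝 y, w (X z) ≤ w (X y) := by
    have h1 : Metric.ball a R ∈ 𝓝 y :=
      Metric.isOpen_ball.mem_nhds (by rw [Metric.mem_ball, dist_eq_norm]; exact hyR)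
    have h2 : ∀ᶠ z in 𝓝 y, ρ < ‖z - q‖ :=
      continuousAt_const.eventually_lt (by fun_prop) hyρ
    filter_upwards [h1, h2] with z hz1 hz2
    refine hymax ⟨Metric.ball_subset_closedBall hz1, ?_⟩
    rw [Metric.mem_ball, dist_eq_norm, not_lt]
    exact hz2.le
  have hyT : y ∈ φ.target := hRT hyK.1
  set p := φ.symm y with hp
  have hps : p ∈ φ.source := φ.map_target hyT
  have hφp : φ p = y := φ.right_inv hyT
  -- Taking the base point at `y` itself makes the secant from `q` nearly tangent to the immersion
  -- at `y`, which bounds the tangential part of `X y - X q` from below.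
  have hsec := (hest y hyK.1 q hqR).2 y hyK.1
  rw [hXdef, fderiv_comp_extChartAt_symm hx.contMDiff p₀ hyT, ← hXdef, hXq] at hsec
  rw [hXq] at hyc
  refine hx.not_isLocalMax_barrier hle hεpos (mul_pos hc hρ) (lt_add_one _)
    (le_trans (by gcongr) hyc) hsec (κ := κ) ?_
  have h1 : Tendsto φ (𝓝 p) (𝓝 y) := by
    rw [← hφp]
    exact continuousAt_extChartAt' hps
  filter_upwards [h1.eventually hmaxX, (isOpen_extChartAt_source p₀).mem_nhds hps] with z hz hzs
  simpa only [hw, hXdef, Function.comp_apply, φ.left_inv hzs, φ.left_inv hqs, hqdef] using hz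

end StrongMaximumPrinciple

/-! ### Constancy of `|x|` -/

section ConstantNorm

variable {m : ℕ} {S : Type*} [TopologicalSpace S] [ChartedSpace (EuclideanSpace ℝ (Fin m)) S]
  [RiemannianBundle (fun p : S ↦ TangentSpace (𝓡 m) p)]
  [IsManifold (𝓡 m) ∞ S] {x : S → EuclideanSpace ℝ (Fin (m + 1))}

/-- At a maximum point of `‖x‖` on a self-shrinker, the position vector is minus the mean
curvature, and its squared norm is at least `m`. -/
theorem IsSelfShrinker.of_isLocalMax_norm (hx : IsSelfShrinker x) {p : S}
    (h : IsLocalMax (fun q ↦ ‖x q‖) p) : x p = -meanCurvature x p ∧ m ≤ ‖x p‖ ^ 2 := by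
  -- With all parameters zero, the barrier is half the squared norm.
  have hb : IsLocalMax (barrier 0 0 0 0 ∘ x) p := by
    filter_upwards [h] with q hq
    simp only [barrier, Function.comp_apply, zero_mul, add_zero]
    have := pow_le_pow_left₀ (norm_nonneg _) hq 2
    linarith
  refine ⟨?_, by simpa using hx.le_of_isLocalMax_barrier hb⟩
  have hd := (hx.sum_hessian_le_of_isLocalMax (hasFDerivAt_barrier 0 0 0 0)
    (hasFDerivAt_barrierDeriv 0 0 0 (x p)) hb).1
  rw [← hx.normalPart_eq p, normalPart, eq_comm, Submodule.starProjection_eq_self_iff,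
    normalSpace, Submodule.mem_orthogonal']
  rintro _ ⟨v, rfl⟩
  simpa [barrierDeriv] using hd v

/-- The curvature bound at the maximum point puts the image in the ball of radius `√m`; the contact
set with its boundary sphere is then closed, open and contains `x₀`. -/
theorem IsSelfShrinker.norm_eq_sqrt (hx : IsSelfShrinker x)
    (hbdd : Bornology.IsBounded (range x)) (hH : ∀ p, ‖meanCurvature x p‖ ≤ √(m : ℝ))
    {x₀ : S} (hsup : ‖x x₀‖ = ⨆ p, ‖x p‖) (p : S) : ‖x p‖ = √(m : ℝ) := by
  have hmax : ∀ q, ‖x q‖ ≤ ‖x x₀‖ := fun q ↦ by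
    rw [hsup]
    obtain ⟨C, hC⟩ := hbdd.exists_norm_le
    exact le_ciSup (f := fun p ↦ ‖x p‖) ⟨C, by rintro _ ⟨q, rfl⟩; exact hC _ ⟨q, rfl⟩⟩ q
  obtain ⟨h1, h2⟩ := hx.of_isLocalMax_norm (Eventually.of_forall hmax)
  have h3 : ‖x x₀‖ ≤ √(m : ℝ) := by rw [h1, norm_neg]; exact hH x₀
  have hle : ∀ q, ‖x q‖ ^ 2 ≤ m := fun q ↦
    (Real.le_sqrt (norm_nonneg _) (Nat.cast_nonneg m)).1 ((hmax q).trans h3)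
  have := hx.connected
  have hclopen : IsClopen {p | ‖x p‖ ^ 2 = m} :=
    ⟨isClosed_eq (hx.contMDiff.continuous.norm.pow 2) continuous_const, hx.isOpen_norm_sq_eq hle⟩
  have huniv := hclopen.eq_univ ⟨x₀, le_antisymm (hle x₀) h2⟩
  have hp : p ∈ {p | ‖x p‖ ^ 2 = m} := huniv ▸ mem_univ p
  rw [← show ‖x p‖ ^ 2 = m from hp, Real.sqrt_sq (norm_nonneg _)]

end ConstantNorm

/-! ### Intrinsic distance bounded locally by ambient distance -/

section Distance

open Manifold MeasureTheory

variable {m : ℕ} {S : Type*} [EMetricSpace S] [ChartedSpace (EuclideanSpace ℝ (Fin m)) S]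
  [IsManifold (𝓡 m) ∞ S] [RiemannianBundle (fun p : S ↦ TangentSpace (𝓡 m) p)]
  [IsRiemannianManifold (𝓡 m) S] {x : S → EuclideanSpace ℝ (Fin (m + 1))}

/-- Locally, the distance of an isometrically immersed manifold is controlled by the distance of
the ambient space. -/
theorem IsIsometricImmersion.exists_nhds_edist_le (hx : IsIsometricImmersion x) (p : S) :
    ∃ U ∈ 𝓝 p, ∀ p₁ ∈ U, ∀ p₂ ∈ U, edist p₁ p₂ ≤ 2 * edist (x p₁) (x p₂) := by
  set φ := extChartAt (𝓡 m) p with hφ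
  set X := x ∘ φ.symm with hXdef
  obtain ⟨c, hc, R, hR, hRT, hest⟩ := exists_closedBall_secant_estimates
    ((contDiffAt_comp_extChartAt_symm hx.contMDiff p (mem_extChartAt_target p)).of_le
      (WithTop.coe_le_coe.2 le_top)) (hx.injective_fderiv_comp_extChartAt_symm p)
    (extChartAt_target_mem_nhds p)
  refine ⟨φ.source ∩ φ ⁻¹' Metric.closedBall (φ p) R,
    inter_mem (extChartAt_source_mem_nhds p) ((continuousAt_extChartAt p).preimage_mem_nhds
      (Metric.closedBall_mem_nhds _ hR)), fun p₁ hp₁ p₂ hp₂ ↦ ?_⟩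
  -- The competitor for the Riemannian distance is the chart segment pulled back to `S`; its speed
  -- is that of its image under `x`, at most `5/4` of the secant length, rounded up to `2`.
  set η : ℝ → EuclideanSpace ℝ (Fin m) := fun t ↦ φ p₁ + t • (φ p₂ - φ p₁) with hη
  have hηd : ∀ t, HasFDerivAt η (ContinuousLinearMap.toSpanSingleton ℝ (φ p₂ - φ p₁)) t :=
    fun t ↦ by
      have := (((hasDerivAt_id t).smul_const (φ p₂ - φ p₁)).const_add (φ p₁)).hasFDerivAt
      rwa [one_smul] at this
  have hηs : ContDiff ℝ 1 η := by rw [hη]; fun_prop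
  have hηball : ∀ t ∈ Icc (0 : ℝ) 1, η t ∈ Metric.closedBall (φ p) R := fun t ht ↦
    (convex_closedBall (φ p) R).add_smul_sub_mem hp₁.2 hp₂.2 ht
  have hsymm : ∀ t ∈ Icc (0 : ℝ) 1, ContMDiffAt 𝓘(ℝ, EuclideanSpace ℝ (Fin m)) (𝓡 m) 1
      φ.symm (η t) := fun t ht ↦ (contMDiffOn_extChartAt_symm p).contMDiffAt
    ((isOpen_extChartAt_target p).mem_nhds (hRT (hηball t ht)))
  have hγ : ContMDiffOn 𝓘(ℝ) (𝓡 m) 1 (φ.symm ∘ η) (Icc 0 1) := fun t ht ↦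
    ((hsymm t ht).comp t hηs.contMDiff.contMDiffAt).contMDiffWithinAt
  have hlen := riemannianEDist_le_pathELength hγ (x := p₁) (y := p₂)
    (by simp only [hη, Function.comp_apply, zero_smul, add_zero]; exact φ.left_inv hp₁.1)
    (by simp only [hη, Function.comp_apply, one_smul, add_sub_cancel]; exact φ.left_inv hp₂.1)
    zero_le_one
  rw [← IsRiemannianManifold.out, pathELength_eq_lintegral_mfderiv_Icc] at hlen
  refine hlen.trans ?_
  have hbound : ∀ t ∈ Icc (0 : ℝ) 1,
      ‖mfderiv 𝓘(ℝ) (𝓡 m) (φ.symm ∘ η) t 1‖ₑ ≤ 2 * edist (x p₁) (x p₂) := by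
    intro t ht
    have hcomp := mfderiv_comp t ((hsymm t ht).mdifferentiableAt one_ne_zero)
      (hηd t).hasMFDerivAt.mdifferentiableAt
    rw [(hηd t).hasMFDerivAt.mfderiv] at hcomp
    have hcomp1 : mfderiv 𝓘(ℝ) (𝓡 m) (φ.symm ∘ η) t 1 =
        mfderiv 𝓘(ℝ, EuclideanSpace ℝ (Fin m)) (𝓡 m) φ.symm (η t) (φ p₂ - φ p₁) := by
      refine (congr($hcomp 1)).trans ?_
      exact congrArg _ (one_smul ℝ (φ p₂ - φ p₁))
    have hfd := fderiv_comp_extChartAt_symm hx.contMDiff p (hRT (hηball t ht)) (φ p₂ - φ p₁)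
    have hX1 : X (φ p₁) = x p₁ := by
      simp only [hXdef, Function.comp_apply, hφ, (extChartAt (𝓡 m) p).left_inv hp₁.1]
    have hX2 : X (φ p₂) = x p₂ := by
      simp only [hXdef, Function.comp_apply, hφ, (extChartAt (𝓡 m) p).left_inv hp₂.1]
    have hs := (hest (φ p₂) hp₂.2 (φ p₁) hp₁.2).2 (η t) (hηball t ht)
    change ‖X _ - X _ - _‖ ≤ _ * ‖X _ - X _‖ at hs
    rw [hX1, hX2] at hs
    have hnorm : ‖fderiv ℝ X (η t) (φ p₂ - φ p₁)‖ ≤ 2 * ‖x p₁ - x p₂‖ := by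
      have := norm_le_norm_add_norm_sub' (fderiv ℝ X (η t) (φ p₂ - φ p₁)) (x p₂ - x p₁)
      rw [norm_sub_rev (fderiv ℝ X (η t) (φ p₂ - φ p₁))] at this
      rw [norm_sub_rev (x p₁)]
      change ‖x p₂ - x p₁ - fderiv ℝ X (η t) (φ p₂ - φ p₁)‖ ≤ _ at hs
      linarith [norm_nonneg (x p₂ - x p₁)]
    have heq : ‖mfderiv 𝓘(ℝ) (𝓡 m) (φ.symm ∘ η) t 1‖ =
        ‖fderiv ℝ X (η t) (φ p₂ - φ p₁)‖ := by
      rw [hcomp1]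
      refine ((congrArg norm hfd).trans (hx.norm_mvfderiv _ _)).symm
    rw [edist_eq_enorm_sub, ← ofReal_norm, ← ofReal_norm, heq]
    exact (ENNReal.ofReal_le_ofReal hnorm).trans_eq
      (by rw [ENNReal.ofReal_mul zero_le_two, ENNReal.ofReal_ofNat])
  calc ∫⁻ t in Icc (0 : ℝ) 1, ‖mfderiv 𝓘(ℝ) (𝓡 m) (φ.symm ∘ η) t 1‖ₑ
      ≤ ∫⁻ _ in Icc (0 : ℝ) 1, 2 * edist (x p₁) (x p₂) :=
        setLIntegral_mono' measurableSet_Icc hbound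
    _ = 2 * edist (x p₁) (x p₂) := by simp

end Distance

/-! ### Lifting Lipschitz paths through a local homeomorphism -/

section PathLifting

open unitInterval
open scoped NNReal ENNReal

variable {S Y : Type*} [EMetricSpace S] [EMetricSpace Y] {q : S → Y}

/-- Distances add along the line, so concatenation does not worsen the constant; the continuation
argument depends on a bound that never grows. -/
theorem lipschitzOnWith_Icc_union {f : ℝ → S} {K : ℝ≥0} {a b c : ℝ}
    (h₁ : LipschitzOnWith K f (Icc a b)) (h₂ : LipschitzOnWith K f (Icc b c)) (hab : a ≤ b)
    (hbc : b ≤ c) : LipschitzOnWith K f (Icc a c) := by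
  have key : ∀ s ∈ Icc a c, ∀ t ∈ Icc a c, s ≤ t → edist (f s) (f t) ≤ K * edist s t := by
    intro s hs t ht hst
    rcases le_total t b with htb | hbt
    · exact h₁ ⟨hs.1, hst.trans htb⟩ ⟨ht.1, htb⟩
    rcases le_total b s with hbs | hsb
    · exact h₂ ⟨hbs, hs.2⟩ ⟨hbt, ht.2⟩
    calc edist (f s) (f t) ≤ edist (f s) (f b) + edist (f b) (f t) := edist_triangle _ _ _
      _ ≤ K * edist s b + K * edist b t :=
          add_le_add (h₁ ⟨hs.1, hsb⟩ ⟨hab, le_rfl⟩) (h₂ ⟨le_rfl, hbc⟩ ⟨hbt, ht.2⟩)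
      _ = K * edist s t := by
          rw [← mul_add, edist_dist, edist_dist, edist_dist, ← ENNReal.ofReal_add dist_nonneg
            dist_nonneg, Real.dist_eq, Real.dist_eq, Real.dist_eq, abs_of_nonpos (by linarith),
            abs_of_nonpos (by linarith), abs_of_nonpos (by linarith)]
          congr 2; ring
  intro s hs t ht
  rcases le_total s t with h | h
  · exact key s hs t ht h
  · rw [edist_comm, edist_comm s]; exact key t ht s hs h

/-- Path lifting for a local homeomorphism `q` out of a complete space which locally does not
shrink distances by more than a fixed factor: every Lipschitz path lifts. -/
theorem exists_lift_of_lipschitzOnWith [CompleteSpace S] (hq : IsLocalHomeomorph q) {K L : ℝ≥0}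
    (hK : ∀ p, ∃ U ∈ 𝓝 p, ∀ p₁ ∈ U, ∀ p₂ ∈ U, edist p₁ p₂ ≤ K * edist (q p₁) (q p₂))
    {γ : ℝ → Y} (hγ : LipschitzOnWith L γ (Icc 0 1)) {e : S} (he : q e = γ 0) :
    ∃ Γ : ℝ → S, ContinuousOn Γ (Icc 0 1) ∧ (∀ t ∈ Icc (0 : ℝ) 1, q (Γ t) = γ t) ∧ Γ 0 = e := by
  -- Continuation in `t`: the uniform constant `K * L` is part of the condition so that partial
  -- lifts converge at a limiting time.
  set A : Set ℝ := {t | ∃ Γ : ℝ → S, LipschitzOnWith (K * L) Γ (Icc 0 t) ∧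
    (∀ s ∈ Icc (0 : ℝ) t, q (Γ s) = γ s) ∧ Γ 0 = e} with hA
  have hsep : IsSeparatedMap q := T2Space.isSeparatedMap q
  have hmono : ∀ t ∈ A, ∀ s ≤ t, s ∈ A := fun t ⟨Γ, h1, h2, h3⟩ s hst ↦
    ⟨Γ, h1.mono (Icc_subset_Icc_right hst),
      fun r hr ↦ h2 r (Icc_subset_Icc_right hst hr), h3⟩
  have h0 : (0 : ℝ) ∈ A := by
    refine ⟨fun _ ↦ e, LipschitzWith.const e |>.lipschitzOnWith |>.weaken zero_le, ?_, rfl⟩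
    intro s hs
    rw [Icc_self, mem_singleton_iff] at hs
    rw [hs, he]
  have hclosed : ∀ T, 0 < T → T ≤ 1 → (∀ t < T, t ∈ A) → T ∈ A := by
    intro T hT hT1 hlt
    have : Nonempty S := ⟨e⟩
    choose! G hGl hGq hG0 using hlt
    -- The partial lifts are glued diagonally: at time `t` the lift up to `r t` is used, and only `t
    -- ≤ r t < T` matters. Uniqueness of lifts makes the choices agree.
    set r : ℝ → ℝ := fun t ↦ (t + T) / 2 with hr
    have hr1 : ∀ t < T, t ≤ r t := fun t ht ↦ by simp only [hr]; linarith
    have hr2 : ∀ t < T, r t < T := fun t ht ↦ by simp only [hr]; linarith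
    have hagree : ∀ s < T, ∀ t < T, s ≤ t → 0 ≤ s → G (r s) s = G (r t) s := by
      intro s hs t ht hst h0s
      refine hsep.eqOn_of_comp_eqOn hq.isLocallyInjective (isPreconnected_Icc (a := (0 : ℝ))
        (b := s)) ((hGl _ (hr2 s hs)).continuousOn.mono (Icc_subset_Icc_right (hr1 s hs)))
        ((hGl _ (hr2 t ht)).continuousOn.mono (Icc_subset_Icc_right (hst.trans (hr1 t ht))))
        (fun u hu ↦ ?_) (a := 0) ⟨le_rfl, h0s⟩ ?_ ⟨h0s, le_rfl⟩
      · simp only [Function.comp_apply]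
        rw [hGq _ (hr2 s hs) u ⟨hu.1, hu.2.trans (hr1 s hs)⟩,
          hGq _ (hr2 t ht) u ⟨hu.1, hu.2.trans (hst.trans (hr1 t ht))⟩]
      · rw [hG0 _ (hr2 s hs), hG0 _ (hr2 t ht)]
    set Γ : ℝ → S := fun t ↦ G (r t) t with hΓ
    have hΓl : LipschitzOnWith (K * L) Γ (Ico 0 T) := by
      have key : ∀ s ∈ Ico 0 T, ∀ t ∈ Ico 0 T, s ≤ t →
          edist (Γ s) (Γ t) ≤ (K * L : ℝ≥0) * edist s t := by
        intro s hs t ht hst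
        simp only [hΓ]
        rw [hagree s hs.2 t ht.2 hst hs.1]
        exact hGl _ (hr2 t ht.2) ⟨hs.1, hst.trans (hr1 t ht.2)⟩ ⟨ht.1, hr1 t ht.2⟩
      intro s hs t ht
      rcases le_total s t with h | h
      · exact key s hs t ht h
      · rw [edist_comm, edist_comm s]; exact key t ht s hs h
    have hne : (𝓝[Ico 0 T] T).NeBot := by
      rw [← mem_closure_iff_nhdsWithin_neBot, closure_Ico hT.ne]
      exact right_mem_Icc.2 hT.le
    -- Here completeness of `S` enters: the Lipschitz lift on `[0, T)` has a limit at `T`.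
    have hcauchy : Cauchy (map Γ (𝓝[Ico 0 T] T)) :=
      (cauchy_nhds.mono nhdsWithin_le_nhds).map_of_le hΓl.uniformContinuousOn inf_le_right
    obtain ⟨z, hz⟩ := CompleteSpace.complete hcauchy
    set Γ' : ℝ → S := Function.update Γ T z with hΓ'
    have hΓ'eq : ∀ t < T, Γ' t = Γ t := fun t ht ↦ Function.update_of_ne ht.ne _ _
    have hΓ'T : Γ' T = z := Function.update_self _ _ _
    have hzT : ∀ s ∈ Ico 0 T, edist (Γ s) z ≤ (K * L : ℝ≥0) * edist s T := fun s hs ↦ by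
      refine le_of_tendsto_of_tendsto (Tendsto.edist tendsto_const_nhds hz)
        (ENNReal.Tendsto.const_mul (Tendsto.edist tendsto_const_nhds
          (tendsto_nhdsWithin_of_tendsto_nhds tendsto_id)) (Or.inr ENNReal.coe_ne_top)) ?_
      exact eventually_nhdsWithin_of_forall fun t ht ↦ hΓl hs ht
    have hlip : LipschitzOnWith (K * L) Γ' (Icc 0 T) := by
      intro s hs t ht
      rcases hs.2.eq_or_lt with rfl | hsT <;> rcases ht.2.eq_or_lt with htT | htT
      · simp [htT]
      · rw [hΓ'T, hΓ'eq t htT, edist_comm, edist_comm s]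
        exact hzT t ⟨ht.1, htT⟩
      · rw [htT, hΓ'T, hΓ'eq s hsT]
        exact hzT s ⟨hs.1, hsT⟩
      · rw [hΓ'eq s hsT, hΓ'eq t htT]
        exact hΓl ⟨hs.1, hsT⟩ ⟨ht.1, htT⟩
    have hΓq : ∀ t ∈ Ico 0 T, q (Γ t) = γ t := fun t ht ↦
      hGq _ (hr2 t ht.2) t ⟨ht.1, hr1 t ht.2⟩
    refine ⟨Γ', hlip, fun t ht ↦ ?_, ?_⟩
    · rcases ht.2.eq_or_lt with rfl | htT
      · rw [hΓ'T]
        have h1 : Tendsto (fun t ↦ q (Γ t)) (𝓝[Ico 0 t] t) (𝓝 (q z)) :=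
          (hq.continuous.tendsto z).comp hz
        have h2 : Tendsto γ (𝓝[Ico 0 t] t) (𝓝 (γ t)) :=
          (hγ.continuousOn t ⟨ht.1, hT1⟩).mono_left
            (nhdsWithin_mono _ (Ico_subset_Icc_self.trans (Icc_subset_Icc_right hT1)))
        exact tendsto_nhds_unique h1
          (h2.congr' (eventually_nhdsWithin_of_forall fun s hs ↦ (hΓq s hs).symm))
      · rw [hΓ'eq t htT]
        exact hΓq t ⟨ht.1, htT⟩
    · rw [hΓ'eq 0 hT]; exact hG0 _ (hr2 0 hT)
  -- The lift is continued by a local inverse of `q`, for a time short enough to remain in a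
  -- neighbourhood `U` where `hK` gives the same constant.
  have hopen : ∀ T ∈ A, 0 ≤ T → T < 1 → ∃ T' ∈ A, T < T' := by
    rintro T ⟨Γ, hl, hΓ, hΓ0⟩ h0T hT1
    obtain ⟨U, hU, hUK⟩ := hK (Γ T)
    obtain ⟨f, hf, hfq⟩ := hq (Γ T)
    subst hfq
    have hγT : γ T = f (Γ T) := (hΓ T ⟨h0T, le_rfl⟩).symm
    have hW : f.target ∩ f.symm ⁻¹' U ∈ 𝓝 (γ T) := by
      rw [hγT]
      refine inter_mem (f.open_target.mem_nhds (f.map_source hf)) ?_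
      refine (f.continuousAt_symm (f.map_source hf)).preimage_mem_nhds ?_
      rwa [f.left_inv hf]
    have hW' : γ ⁻¹' (f.target ∩ f.symm ⁻¹' U) ∈ 𝓝[≥] T := by
      rw [← nhdsWithin_Icc_eq_nhdsGE hT1]
      exact nhdsWithin_mono _ (Icc_subset_Icc_left h0T) (hγ.continuousOn T ⟨h0T, hT1.le⟩ hW)
    obtain ⟨u, hu, huW⟩ := (mem_nhdsGE_iff_exists_Icc_subset (a := T)).1 hW'
    set T' := min u 1 with hT'
    have hTT' : T < T' := lt_min hu hT1
    have hsub : ∀ t ∈ Icc T T', γ t ∈ f.target ∧ f.symm (γ t) ∈ U := fun t ht ↦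
      huW ⟨ht.1, ht.2.trans (min_le_left _ _)⟩
    set Γ' : ℝ → S := fun t ↦ if t ≤ T then Γ t else f.symm (γ t) with hΓ'
    have hleft : ∀ t ≤ T, Γ' t = Γ t := fun t ht ↦ if_pos ht
    have hright : ∀ t ∈ Icc T T', Γ' t = f.symm (γ t) := fun t ht ↦ by
      rcases ht.1.eq_or_lt with rfl | hlt
      · rw [hleft _ le_rfl, hγT, f.left_inv hf]
      · exact if_neg hlt.not_ge
    refine ⟨T', ⟨Γ', lipschitzOnWith_Icc_union (b := T) ?_ ?_ h0T hTT'.le, fun t ht ↦ ?_, ?_⟩, hTT'⟩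
    · intro s hs t ht
      rw [hleft s hs.2, hleft t ht.2]
      exact hl hs ht
    · intro s hs t ht
      rw [hright s hs, hright t ht]
      refine (hUK _ (hsub s hs).2 _ (hsub t ht).2).trans ?_
      rw [f.right_inv (hsub s hs).1, f.right_inv (hsub t ht).1, ENNReal.coe_mul, mul_assoc]
      gcongr
      exact hγ ⟨h0T.trans hs.1, hs.2.trans (min_le_right _ _)⟩
        ⟨h0T.trans ht.1, ht.2.trans (min_le_right _ _)⟩
    · rcases le_total t T with h | h
      · rw [hleft t h]
        exact hΓ t ⟨ht.1, h⟩
      · rw [hright t ⟨h, ht.2⟩, f.right_inv (hsub t ⟨h, ht.2⟩).1]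
    · rw [hleft 0 h0T, hΓ0]
  have hone : (1 : ℝ) ∈ A := by
    have hbdd : BddAbove (A ∩ Icc 0 1) := ⟨1, fun t ht ↦ ht.2.2⟩
    have h0' : (0 : ℝ) ∈ A ∩ Icc 0 1 := ⟨h0, le_rfl, zero_le_one⟩
    set T := sSup (A ∩ Icc 0 1) with hT
    have hT0 : 0 ≤ T := le_csSup hbdd h0'
    have hT1 : T ≤ 1 := csSup_le ⟨0, h0'⟩ fun t ht ↦ ht.2.2
    have hTA : T ∈ A := by
      rcases hT0.eq_or_lt with h | h
      · rwa [← h]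
      · refine hclosed T h hT1 fun t ht ↦ ?_
        obtain ⟨s, hs, hts⟩ := exists_lt_of_lt_csSup ⟨0, h0'⟩ ht
        exact hmono s hs.1 t hts.le
    rcases hT1.eq_or_lt with h | h
    · rwa [← h]
    · obtain ⟨T', hT'A, hTT'⟩ := hopen T hTA hT0 h
      have : min T' 1 ≤ T := le_csSup hbdd ⟨hmono T' hT'A _ (min_le_left _ _),
        le_min (hT0.trans hTT'.le) zero_le_one, min_le_right _ _⟩
      exact absurd this (not_le.2 (lt_min hTT' h))
  obtain ⟨Γ, h1, h2, h3⟩ := hone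
  exact ⟨Γ, h1.continuousOn, h2, h3⟩

end PathLifting

/-! ### From lifted charts to coverings and injectivity -/

section Sections

open unitInterval
open scoped NNReal

/-- Lifting a map from a vector space along its segments. -/
theorem exists_continuousMap_lift {S Y V : Type*} [EMetricSpace S] [CompleteSpace S]
    [EMetricSpace Y] [NormedAddCommGroup V] [NormedSpace ℝ V] {q : S → Y}
    (hq : IsLocalHomeomorph q) {K : ℝ≥0}
    (hK : ∀ p, ∃ U ∈ 𝓝 p, ∀ p₁ ∈ U, ∀ p₂ ∈ U, edist p₁ p₂ ≤ K * edist (q p₁) (q p₂))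
    {j : V → Y} (hj : Continuous j)
    (hlip : ∀ w₀ w, ∃ L : ℝ≥0, LipschitzOnWith L (fun t : ℝ ↦ j (w₀ + t • (w - w₀))) (Icc 0 1))
    {w₀ : V} {p : S} (hp : q p = j w₀) :
    ∃ s : V → S, Continuous s ∧ (∀ w, q (s w) = j w) ∧ s w₀ = p := by
  choose L hL using hlip
  have hex := fun w ↦ exists_lift_of_lipschitzOnWith hq hK (hL w₀ w) (e := p) (by simp [hp])
  choose Γ hΓc hΓq hΓ0 using hex
  set f : C(I × V, Y) := ⟨fun tw ↦ j (w₀ + (tw.1 : ℝ) • (tw.2 - w₀)), by fun_prop⟩ with hf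
  set g : I × V → S := fun tw ↦ Γ tw.2 tw.1 with hg
  have hgf : q ∘ g = f := funext fun tw ↦ hΓq tw.2 tw.1 tw.1.2
  have hgc : Continuous g := by
    -- The lifts were chosen separately for each `w`; joint continuity follows from continuity in
    -- `t` and at the common initial point.
    refine hq.continuous_lift (T2Space.isSeparatedMap q) f hgf ?_ fun w ↦ ?_
    · have : (fun w ↦ g (0, w)) = fun _ ↦ p := funext fun w ↦ hΓ0 w
      rw [this]; exact continuous_const
    · exact continuousOn_iff_continuous_domRestrict.1 (hΓc w)
  refine ⟨fun w ↦ g (1, w), by fun_prop, fun w ↦ ?_, ?_⟩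
  · have := congrFun hgf (1, w)
    simpa [hf] using this
  · have : (fun t : I ↦ g (t, w₀)) = fun _ ↦ p := by
      refine (T2Space.isSeparatedMap q).eq_of_comp_eq hq.isLocallyInjective (by fun_prop)
        continuous_const (funext fun t ↦ ?_) 0 (hΓ0 w₀)
      have := congrFun hgf (t, w₀)
      simpa [hf, hp] using this
    exact congrFun this 1

variable {S Y V : Type*} [TopologicalSpace S] [TopologicalSpace Y] [TopologicalSpace V] {q : S → Y}

/-- The inverse of the chart `j` lifts through `q`, with prescribed value at a given point. -/
def HasSections (q : S → Y) (j : OpenPartialHomeomorph Y V) : Prop :=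
  ∀ w₀ p, q p = j.symm w₀ → ∃ s : V → S, Continuous s ∧ (∀ w, q (s w) = j.symm w) ∧ s w₀ = p

/-- A chart onto a connected space whose inverse lifts through the local homeomorphism `q` has an
evenly covered domain. -/
theorem isEvenlyCovered_of_hasSections [T2Space S] [PreconnectedSpace V]
    (hq : IsLocalHomeomorph q)
    {j : OpenPartialHomeomorph Y V} (hjt : j.target = univ) (hj : HasSections q j) {y : Y}
    (hy : y ∈ j.source) (hne : y ∈ range q) : IsEvenlyCovered q y (q ⁻¹' {y}) := by
  have hsep : IsSeparatedMap q := T2Space.isSeparatedMap q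
  obtain ⟨p₀, hp₀⟩ := hne
  have hex : ∀ i : q ⁻¹' {y}, ∃ s : V → S, Continuous s ∧ (∀ w, q (s w) = j.symm w) ∧
      s (j y) = i.1 := fun i ↦ hj (j y) i.1 (by rw [show q i = y from i.2, j.left_inv hy])
  choose τ hτc hτq hτy using hex
  have hunique : ∀ s s' : V → S, Continuous s → Continuous s' → (∀ w, q (s w) = j.symm w) →
      (∀ w, q (s' w) = j.symm w) → ∀ w, s w = s' w → s = s' := fun s s' hs hs' h h' w hw ↦
    hsep.eq_of_comp_eq hq.isLocallyInjective hs hs' (funext fun v ↦ by simp [h, h']) w hw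
  -- The candidate sheets are the images of the sections through the points of the fibre over `y`.
  have hopen : ∀ i, IsOpen (range (τ i)) := fun i ↦ by
    have hemb : IsOpenEmbedding (q ∘ τ i) := by
      have : q ∘ τ i = j.symm := funext (hτq i)
      rw [this]
      exact j.symm.isOpenEmbedding hjt
    exact (hq.isOpenEmbedding_of_comp hemb (hτc i)).isOpen_range
  have hsurj : ∀ i, (range (τ i)).SurjOn q j.source := fun i v hv ↦
    ⟨τ i (j v), mem_range_self _, by rw [hτq, j.left_inv hv]⟩
  have : Nonempty (q ⁻¹' {y}) := ⟨⟨p₀, hp₀⟩⟩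
  have : Nonempty (Y → S) := ⟨fun _ ↦ p₀⟩
  have hdisc : DiscreteTopology (q ⁻¹' {y}) := by
    have : Subsingleton (q '' (q ⁻¹' {y})) :=
      (subsingleton_singleton.anti (image_preimage_subset q {y})).coe_sort
    exact (hq.isLocalHomeomorphOn (s := q ⁻¹' {y})).discreteTopology_of_image
  refine IsEvenlyCovered.of_trivialization
    (t := IsOpen.trivializationDiscrete (fun i ↦ range (τ i)) j.source j.open_source
      (fun i W hW ↦ ⟨fun h ↦ (h.preimage hq.continuous).inter (hopen i), fun h ↦ ?_⟩)
      (fun i ↦ ?_) hsurj (fun i i' hii' ↦ ?_) (fun p hp ↦ ?_)) hy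
  · have : W = q '' (q ⁻¹' W ∩ range (τ i)) := by
      refine Subset.antisymm (fun v hv ↦ ?_) (by rintro _ ⟨p, hp, rfl⟩; exact hp.1)
      obtain ⟨p, hp, rfl⟩ := hsurj i (hW hv)
      exact ⟨p, ⟨hv, hp⟩, rfl⟩
    rw [this]
    exact hq.isOpenMap _ h
  · rintro _ ⟨w, rfl⟩ _ ⟨w', rfl⟩ h
    rw [hτq, hτq] at h
    rw [j.symm.injOn (by simp [hjt]) (by simp [hjt]) h]
  · rw [Function.onFun, Set.disjoint_left]
    rintro _ ⟨w, rfl⟩ ⟨w', h⟩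
    have hw : w' = w := by
      have := congrArg q h
      rw [hτq, hτq] at this
      exact j.symm.injOn (by simp [hjt]) (by simp [hjt]) this
    rw [hw] at h
    have := hunique _ _ (hτc i') (hτc i) (hτq i') (hτq i) w h
    exact hii' (Subtype.ext (by rw [← hτy, ← hτy, this]))
  -- The section through `p` takes some value over `y`, and uniqueness identifies it with the
  -- section indexed by that value, so `p` lies on a sheet.
  · obtain ⟨s, hsc, hsq, hsp⟩ := hj (j (q p)) p (j.left_inv hp).symm
    have hmem : s (j y) ∈ q ⁻¹' {y} := by simp [hsq, j.left_inv hy]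
    have := hunique _ _ hsc (hτc ⟨_, hmem⟩) hsq (hτq _) (j y) (hτy ⟨_, hmem⟩).symm
    exact mem_iUnion.2 ⟨⟨_, hmem⟩, j (q p), by rw [← this, hsp]⟩

/-- If `Y` is the union of two charts as in `HasSections` with connected intersection, then the
local homeomorphism `q` is injective. -/
theorem injective_of_hasSections [T2Space S] [PreconnectedSpace S] (hq : IsLocalHomeomorph q)
    {j₁ j₂ : OpenPartialHomeomorph Y V} (hj₁ : HasSections q j₁) (hj₂ : HasSections q j₂)
    (hcover : j₁.source ∪ j₂.source = univ) (hconn : IsPreconnected (j₁.source ∩ j₂.source))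
    {p : S} (hp : q p ∈ j₁.source ∩ j₂.source) : Function.Injective q := by
  classical
  have hsep : IsSeparatedMap q := T2Space.isSeparatedMap q
  obtain ⟨s₁, hs₁c, hs₁q, hs₁p⟩ := hj₁ (j₁ (q p)) p (j₁.left_inv hp.1).symm
  obtain ⟨s₂, hs₂c, hs₂q, hs₂p⟩ := hj₂ (j₂ (q p)) p (j₂.left_inv hp.2).symm
  have hagree : EqOn (s₁ ∘ j₁) (s₂ ∘ j₂) (j₁.source ∩ j₂.source) := by
    refine hsep.eqOn_of_comp_eqOn hq.isLocallyInjective hconn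
      (hs₁c.comp_continuousOn (j₁.continuousOn.mono inter_subset_left))
      (hs₂c.comp_continuousOn (j₂.continuousOn.mono inter_subset_right)) (fun v hv ↦ ?_) hp
      (by simp [hs₁p, hs₂p])
    simp [hs₁q, hs₂q, j₁.left_inv hv.1, j₂.left_inv hv.2]
  set τ : Y → S := fun v ↦ if v ∈ j₁.source then s₁ (j₁ v) else s₂ (j₂ v) with hτ
  have hτ₁ : EqOn τ (s₁ ∘ j₁) j₁.source := fun v hv ↦ if_pos hv
  have hτ₂ : EqOn τ (s₂ ∘ j₂) j₂.source := fun v hv ↦ by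
    by_cases h : v ∈ j₁.source
    · rw [hτ₁ h, hagree ⟨h, hv⟩]
    · exact if_neg h
  have hτc : Continuous τ := by
    refine continuous_iff_continuousAt.2 fun v ↦ ?_
    rcases (hcover ▸ mem_univ v : v ∈ j₁.source ∪ j₂.source) with h | h
    · exact ((hs₁c.comp_continuousOn j₁.continuousOn).congr hτ₁).continuousAt
        (j₁.open_source.mem_nhds h)
    · exact ((hs₂c.comp_continuousOn j₂.continuousOn).congr hτ₂).continuousAt
        (j₂.open_source.mem_nhds h)
  have hτq : ∀ v, q (τ v) = v := fun v ↦ by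
    rcases (hcover ▸ mem_univ v : v ∈ j₁.source ∪ j₂.source) with h | h
    · rw [hτ₁ h, Function.comp_apply, hs₁q, j₁.left_inv h]
    · rw [hτ₂ h, Function.comp_apply, hs₂q, j₂.left_inv h]
  -- Both maps lift `q` through itself and agree at `p`; on the connected `S` they coincide.
  have hid : τ ∘ q = id := hsep.eq_of_comp_eq hq.isLocallyInjective
    (hτc.comp hq.continuous) continuous_id (funext fun r ↦ hτq (q r)) p
    (by simp [hτ₁ hp.1, hs₁p])
  exact Function.LeftInverse.injective (g := τ) (congrFun hid)

/-- A local homeomorphism with sections over charts around all points of a connected space is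
surjective. -/
theorem surjective_of_hasSections [Nonempty S] [PreconnectedSpace Y] (hq : IsLocalHomeomorph q)
    (h : ∀ y, ∃ j : OpenPartialHomeomorph Y V, y ∈ j.source ∧ HasSections q j) :
    Function.Surjective q := by
  rw [← range_eq_univ]
  refine IsClopen.eq_univ ⟨⟨?_⟩, hq.isOpenMap.isOpen_range⟩ (range_nonempty q)
  refine isOpen_iff_mem_nhds.2 fun y hy ↦ ?_
  obtain ⟨j, hyj, hj⟩ := h y
  filter_upwards [j.open_source.mem_nhds hyj] with z hz
  -- If the chart domain around `y` met the range, a section over it would put `y` in the range too;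
  -- so the complement of the range is open.
  rintro ⟨p, rfl⟩
  obtain ⟨s, -, hs, -⟩ := hj (j (q p)) p (j.left_inv hz).symm
  exact hy ⟨s (j y), by rw [hs, j.left_inv hyj]⟩

end Sections

/-! ### The inverse function theorem on manifolds -/

section InverseFunction

variable {m : ℕ} {M N : Type*} [TopologicalSpace M] [ChartedSpace (EuclideanSpace ℝ (Fin m)) M]
  [IsManifold (𝓡 m) ∞ M] [TopologicalSpace N] [ChartedSpace (EuclideanSpace ℝ (Fin m)) N]
  [IsManifold (𝓡 m) ∞ N]

/-- The inverse function theorem for a smooth map with injective differential between manifolds of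
the same dimension. -/
theorem exists_openPartialHomeomorph_of_injective_mfderiv {f : M → N}
    (hf : ContMDiff (𝓡 m) (𝓡 m) ∞ f) {p : M}
    (hinj : Function.Injective (mfderiv (𝓡 m) (𝓡 m) f p)) :
    ∃ e : OpenPartialHomeomorph M N, p ∈ e.source ∧ EqOn f e e.source ∧
      ContMDiffAt (𝓡 m) (𝓡 m) ∞ e.symm (f p) := by
  set φ := chartAt (EuclideanSpace ℝ (Fin m)) p with hφ
  set ψ := chartAt (EuclideanSpace ℝ (Fin m)) (f p) with hψ
  have hpφ : p ∈ φ.source := mem_chart_source _ p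
  have hpψ : f p ∈ ψ.source := mem_chart_source _ (f p)
  set G : EuclideanSpace ℝ (Fin m) → EuclideanSpace ℝ (Fin m) := ψ ∘ f ∘ φ.symm with hG
  have hfp := (contMDiffAt_iff (I := 𝓡 m) (I' := 𝓡 m)).1 (hf p)
  have hGs : ContDiffAt ℝ ∞ G (φ p) := by
    have := hfp.2
    simp only [mfld_simps, contDiffWithinAt_univ] at this
    exact this
  set D : EuclideanSpace ℝ (Fin m) →L[ℝ] EuclideanSpace ℝ (Fin m) := fderiv ℝ G (φ p) with hD
  have hDinj : Function.Injective D := by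
    have h1 := ((hf p).mdifferentiableAt (by simp)).mfderiv
    simp only [mfld_simps, fderivWithin_univ] at h1
    have h2 : (mfderiv (𝓡 m) (𝓡 m) f p : TangentSpace (𝓡 m) p → TangentSpace (𝓡 m) (f p)) = D :=
      congrArg DFunLike.coe h1
    rw [← h2]
    exact hinj
  let D' : EuclideanSpace ℝ (Fin m) ≃L[ℝ] EuclideanSpace ℝ (Fin m) :=
    (LinearEquiv.ofInjectiveEndo D.toLinearMap hDinj).toContinuousLinearEquiv
  have hGd : HasFDerivAt G (D' : EuclideanSpace ℝ (Fin m) →L[ℝ] EuclideanSpace ℝ (Fin m)) (φ p) :=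
    (hGs.differentiableAt (by simp)).hasFDerivAt
  set g := hGs.toOpenPartialHomeomorph G hGd (by simp) with hg
  have hgs : φ p ∈ g.source := hGs.mem_toOpenPartialHomeomorph_source hGd (by simp)
  have hGp : G (φ p) = ψ (f p) := by simp [hG, φ.left_inv hpφ]
  have hgG : ⇑g = G := rfl
  have hopen : IsOpen (f ⁻¹' ψ.source) := ψ.open_source.preimage hf.continuous
  -- Outside `ψ.source` the composite `ψ.symm ∘ ψ ∘ f` need not equal `f`, hence the restriction.
  set e := ((φ.trans g).trans ψ.symm).restrOpen (f ⁻¹' ψ.source) hopen with he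
  have hmem : ∀ r, r ∈ e.source → r ∈ φ.source ∧ f r ∈ ψ.source := fun r hr ↦ by
    simp only [he, OpenPartialHomeomorph.restrOpen_source, mem_inter_iff,
      OpenPartialHomeomorph.trans_source, mem_preimage] at hr
    exact ⟨hr.1.1.1, hr.2⟩
  have heq : EqOn f e e.source := fun r hr ↦ by
    obtain ⟨h1, h2⟩ := hmem r hr
    change f r = ψ.symm (G (φ r))
    simp only [hG, Function.comp_apply, φ.left_inv h1, ψ.left_inv h2]
  have hpe : p ∈ e.source := by
    simp only [he, OpenPartialHomeomorph.restrOpen_source, mem_inter_iff,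
      OpenPartialHomeomorph.trans_source, mem_preimage, OpenPartialHomeomorph.symm_source,
      OpenPartialHomeomorph.coe_trans, Function.comp_apply]
    refine ⟨⟨⟨hpφ, hgs⟩, ?_⟩, hpψ⟩
    rw [hgG, hGp]
    exact ψ.map_source hpψ
  refine ⟨e, hpe, heq, ?_⟩
  have h1 : ContMDiffAt (𝓡 m) 𝓘(ℝ, EuclideanSpace ℝ (Fin m)) ∞ ψ (f p) :=
    contMDiffAt_of_mem_maximalAtlas (IsManifold.chart_mem_maximalAtlas _) hpψ
  have h2 : ContMDiffAt 𝓘(ℝ, EuclideanSpace ℝ (Fin m)) 𝓘(ℝ, EuclideanSpace ℝ (Fin m)) ∞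
      g.symm (ψ (f p)) := by
    rw [← hGp]
    exact (hGs.to_localInverse hGd (by simp)).contMDiffAt
  have h3 : ContMDiffAt 𝓘(ℝ, EuclideanSpace ℝ (Fin m)) (𝓡 m) ∞ φ.symm
      (g.symm (ψ (f p))) := by
    rw [← hGp, ← hgG, g.left_inv hgs]
    exact contMDiffAt_symm_of_mem_maximalAtlas (IsManifold.chart_mem_maximalAtlas _)
      (φ.map_source hpφ)
  exact ContMDiffAt.comp (g := φ.symm) (f := g.symm ∘ ψ) (f p) h3 (h2.comp (f p) h1)

end InverseFunction

/-! ### Stereographic charts and homotheties of the sphere -/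

section Sphere

open Metric
open scoped NNReal

variable {m : ℕ}

/-- Segments in a stereographic chart of the sphere are Lipschitz paths. -/
theorem exists_lipschitzOnWith_stereographic'_symm
    [Fact (Module.finrank ℝ (EuclideanSpace ℝ (Fin (m + 1))) = m + 1)]
    (v : sphere (0 : EuclideanSpace ℝ (Fin (m + 1))) 1) (w₀ w : EuclideanSpace ℝ (Fin m)) :
    ∃ L : ℝ≥0, LipschitzOnWith L
      (fun t : ℝ ↦ (stereographic' m v).symm (w₀ + t • (w - w₀))) (Icc 0 1) := by
  have hs : ContMDiff 𝓘(ℝ, EuclideanSpace ℝ (Fin m)) (𝓡 m) 1 (stereographic' m v).symm := by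
    rw [← contMDiffOn_univ, ← stereographic'_target v]
    exact contMDiffOn_symm_of_mem_maximalAtlas
      (IsManifold.subset_maximalAtlas ⟨v, rfl⟩)
  have hc : ContDiff ℝ 1 (fun z ↦ ((stereographic' m v).symm z :
      EuclideanSpace ℝ (Fin (m + 1)))) :=
    contMDiff_iff_contDiff.1 (contMDiff_coe_sphere.comp hs)
  have hη : ContDiff ℝ 1 (fun t : ℝ ↦ w₀ + t • (w - w₀)) := by fun_prop
  obtain ⟨L, hL⟩ := (hc.comp hη).contDiffOn.exists_lipschitzOnWith one_ne_zero
    (convex_Icc (0 : ℝ) 1) isCompact_Icc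
  exact ⟨L, hL⟩

/-- Stereographic projection from `u` turns the set into Euclidean `m`-space minus a point,
connected as soon as `m ≥ 2`. -/
theorem isConnected_compl_singleton_inter_compl_singleton (hm : 2 ≤ m)
    {u v : sphere (0 : EuclideanSpace ℝ (Fin (m + 1))) 1} (huv : u ≠ v) :
    IsConnected (({u} : Set (sphere (0 : EuclideanSpace ℝ (Fin (m + 1))) 1))ᶜ ∩ {v}ᶜ) := by
  have := Fact.mk (@finrank_euclideanSpace_fin ℝ _ (m + 1))
  set j := stereographic' m u with hj
  have hv : v ∈ j.source := by simpa [hj] using huv.symm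
  have hrank : 1 < Module.rank ℝ (EuclideanSpace ℝ (Fin m)) := by
    rw [← Module.finrank_eq_rank, finrank_euclideanSpace_fin]
    exact_mod_cast hm
  have himage : ({u}ᶜ ∩ {v}ᶜ : Set (sphere (0 : EuclideanSpace ℝ (Fin (m + 1))) 1)) =
      j.symm '' {j v}ᶜ := by
    have hsrc : j.source = {u}ᶜ := stereographic'_source u
    have htgt : j.target = univ := stereographic'_target u
    ext z
    constructor
    · rintro ⟨hz, hzv⟩
      rw [← hsrc] at hz
      exact ⟨j z, fun h ↦ hzv (j.injOn hz hv h), j.left_inv hz⟩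
    · rintro ⟨w, hw, rfl⟩
      have hwt : w ∈ j.target := htgt ▸ mem_univ w
      refine ⟨hsrc ▸ j.map_target hwt, fun h ↦ hw ?_⟩
      rw [mem_singleton_iff] at h ⊢
      rw [← h, j.right_inv hwt]
  rw [himage]
  refine (isConnected_compl_singleton_of_one_lt_rank hrank (j v)).image _ ?_
  exact j.continuousOn_symm.mono (by rw [hj, stereographic'_target]; exact subset_univ _)

/-- The homothety from the unit sphere to the sphere of radius `r`. -/
def sphereHomothety {F : Type*} [NormedAddCommGroup F] [NormedSpace ℝ F] {r : ℝ} (hr : 0 < r) :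
    sphere (0 : F) 1 ≃ₜ sphere (0 : F) r where
  toFun v := ⟨r • (v : F), by
    simp [norm_smul, abs_of_pos hr]⟩
  invFun v := ⟨r⁻¹ • (v : F), by
    simp [norm_smul, abs_of_pos hr, hr.ne']⟩
  left_inv v := Subtype.ext (by simp [smul_smul, hr.ne'])
  right_inv v := Subtype.ext (by simp [smul_smul, hr.ne'])
  continuous_toFun := by fun_prop
  continuous_invFun := by fun_prop

end Sphere

/-! ### Isometric immersions into a sphere -/

section LocalIsometry

open Metric
open scoped NNReal

variable {m : ℕ} {S : Type*} [EMetricSpace S] [ChartedSpace (EuclideanSpace ℝ (Fin m)) S]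
  [IsManifold (𝓡 m) ∞ S] [RiemannianBundle (fun p : S ↦ TangentSpace (𝓡 m) p)]
  {x : S → EuclideanSpace ℝ (Fin (m + 1))} {r : ℝ}
  {q : S → sphere (0 : EuclideanSpace ℝ (Fin (m + 1))) 1}

theorem contMDiff_of_eq_smul (hx : IsIsometricImmersion x) (hr : 0 < r)
    (hq : ∀ p, x p = r • (q p : EuclideanSpace ℝ (Fin (m + 1)))) :
    ContMDiff (𝓡 m) (𝓡 m) ∞ q := by
  have := Fact.mk (@finrank_euclideanSpace_fin ℝ _ (m + 1))
  have h : (fun p ↦ (q p : EuclideanSpace ℝ (Fin (m + 1)))) = fun p ↦ r⁻¹ • x p := by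
    funext p
    rw [hq, smul_smul, inv_mul_cancel₀ hr.ne', one_smul]
  have h1 : ContMDiff (𝓡 m) 𝓘(ℝ, EuclideanSpace ℝ (Fin (m + 1))) ∞
      (fun p ↦ (q p : EuclideanSpace ℝ (Fin (m + 1)))) := by
    rw [h]
    exact (contDiff_const_smul r⁻¹).contMDiff.comp hx.contMDiff
  exact h1.codRestrict_sphere fun p ↦ (q p).2

theorem injective_mfderiv_of_eq_smul (hx : IsIsometricImmersion x) (hr : 0 < r)
    (hq : ∀ p, x p = r • (q p : EuclideanSpace ℝ (Fin (m + 1)))) (p : S) :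
    Function.Injective (mfderiv (𝓡 m) (𝓡 m) q p) := by
  have := Fact.mk (@finrank_euclideanSpace_fin ℝ _ (m + 1))
  have hg : ContMDiff (𝓡 m) 𝓘(ℝ, EuclideanSpace ℝ (Fin (m + 1))) ∞
      (fun v : sphere (0 : EuclideanSpace ℝ (Fin (m + 1))) 1 ↦
        r • (v : EuclideanSpace ℝ (Fin (m + 1)))) :=
    (contDiff_const_smul r).contMDiff.comp contMDiff_coe_sphere
  have hcomp := mfderiv_comp p ((hg (q p)).mdifferentiableAt (by simp))
    ((contMDiff_of_eq_smul hx hr hq p).mdifferentiableAt (by simp))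
  have hx' : (fun v : sphere (0 : EuclideanSpace ℝ (Fin (m + 1))) 1 ↦
      r • (v : EuclideanSpace ℝ (Fin (m + 1)))) ∘ q = x := funext fun p ↦ (hq p).symm
  rw [hx'] at hcomp
  intro v w hvw
  refine hx.injective_mvfderiv p ?_
  have hv := congr($hcomp v)
  have hw := congr($hcomp w)
  exact hv.trans ((congrArg _ hvw).trans hw.symm)

theorem isLocalHomeomorph_of_eq_smul (hx : IsIsometricImmersion x) (hr : 0 < r)
    (hq : ∀ p, x p = r • (q p : EuclideanSpace ℝ (Fin (m + 1)))) : IsLocalHomeomorph q :=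
  IsLocalHomeomorph.mk q fun p ↦
    have ⟨e, h1, h2, _⟩ := exists_openPartialHomeomorph_of_injective_mfderiv
      (contMDiff_of_eq_smul hx hr hq) (injective_mfderiv_of_eq_smul hx hr hq p)
    ⟨e, h1, h2⟩

/-- Path lifting applies with constant `2 * r`: the factor `2` compares intrinsic and ambient
distances, and `r` accounts for the rescaling from `x` to `q`. -/
theorem hasSections_of_eq_smul [IsRiemannianManifold (𝓡 m) S] [CompleteSpace S]
    [Fact (Module.finrank ℝ (EuclideanSpace ℝ (Fin (m + 1))) = m + 1)]
    (hx : IsIsometricImmersion x) (hr : 0 < r)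
    (hq : ∀ p, x p = r • (q p : EuclideanSpace ℝ (Fin (m + 1))))
    (v : sphere (0 : EuclideanSpace ℝ (Fin (m + 1))) 1) :
    HasSections q (stereographic' m v) := by
  intro w₀ p hp
  refine exists_continuousMap_lift (isLocalHomeomorph_of_eq_smul hx hr hq) (K := 2 * ‖r‖₊)
    (fun p ↦ ?_) ?_ (exists_lipschitzOnWith_stereographic'_symm v) hp
  · obtain ⟨U, hU, h⟩ := hx.exists_nhds_edist_le p
    refine ⟨U, hU, fun p₁ h₁ p₂ h₂ ↦ (h p₁ h₁ p₂ h₂).trans_eq ?_⟩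
    rw [hq, hq, edist_smul₀, Subtype.edist_eq, ENNReal.coe_mul, mul_assoc,
      ENNReal.smul_def, smul_eq_mul, ENNReal.coe_ofNat]
  · have := (stereographic' m v).continuousOn_symm
    rwa [stereographic'_target, continuousOn_univ] at this

/-- A diffeomorphism from an injective local isometry onto a sphere. -/
theorem exists_diffeomorph_of_bijective (hx : IsIsometricImmersion x) (hr : 0 < r)
    (hq : ∀ p, x p = r • (q p : EuclideanSpace ℝ (Fin (m + 1))))
    (hbij : Function.Bijective q) :
    ∃ Φ : S ≃ₘ⟮𝓡 m, 𝓡 m⟯ sphere (0 : EuclideanSpace ℝ (Fin (m + 1))) 1, ⇑Φ = q := by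
  set Φ := Equiv.ofBijective q hbij with hΦ
  have hsymm : ContMDiff (𝓡 m) (𝓡 m) ∞ Φ.symm := by
    intro v
    obtain ⟨p, rfl⟩ := hbij.2 v
    obtain ⟨e, h1, h2, h3⟩ := exists_openPartialHomeomorph_of_injective_mfderiv
      (contMDiff_of_eq_smul hx hr hq) (injective_mfderiv_of_eq_smul hx hr hq p)
    refine h3.congr_of_eventuallyEq ?_
    have hmem : e.target ∈ 𝓝 (q p) := e.open_target.mem_nhds (h2 h1 ▸ e.map_source h1)
    filter_upwards [hmem] with z hz
    rw [Equiv.symm_apply_eq]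
    change z = q (e.symm z)
    rw [h2 (e.map_target hz), e.right_inv hz]
  exact ⟨⟨Φ, contMDiff_of_eq_smul hx hr hq, hsymm⟩, rfl⟩

end LocalIsometry

end Shrinker

end

/-- Complete bounded self-shrinkers `x : S → ℝ^{m+1}` with `|H| ≤ √m` such that `|x|` attains its
supremum. Since `x` is an isometric immersion, the second conclusion says that `x` is a Riemannian
covering of the sphere of radius `√m`, and the third that, for `m ≥ 2`, `x` is an isometry of `S`
onto this sphere, which is `√m` times the unit sphere as a smooth manifold. -/
theorem mainTheorem8 (m : ℕ) (hm : 1 ≤ m)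
    {S : Type*} [EMetricSpace S] [ChartedSpace (EuclideanSpace ℝ (Fin m)) S]
    [IsManifold (𝓡 m) ∞ S]
    [RiemannianBundle (fun p : S ↦ TangentSpace (𝓡 m) p)]
    [IsContMDiffRiemannianBundle (𝓡 m) ∞ (EuclideanSpace ℝ (Fin m))
      (fun p : S ↦ TangentSpace (𝓡 m) p)]
    [IsRiemannianManifold (𝓡 m) S] [CompleteSpace S]
    (x : S → EuclideanSpace ℝ (Fin (m + 1)))
    (hx : Shrinker.IsSelfShrinker x)
    (hbdd : Bornology.IsBounded (Set.range x))
    (hH : ∀ p, ‖Shrinker.meanCurvature x p‖ ≤ √(m : ℝ))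
    (x₀ : S) (hsup : ‖x x₀‖ = ⨆ p, ‖x p‖) :
    (∀ p, ‖x p‖ = √(m : ℝ)) ∧
    (∃ q : S → Metric.sphere (0 : EuclideanSpace ℝ (Fin (m + 1))) √(m : ℝ),
      (∀ p, (q p : EuclideanSpace ℝ (Fin (m + 1))) = x p) ∧
        IsCoveringMap q ∧ Function.Surjective q) ∧
    (2 ≤ m →
      ∃ Φ : S ≃ₘ⟮𝓡 m, 𝓡 m⟯ Metric.sphere (0 : EuclideanSpace ℝ (Fin (m + 1))) 1,
        ∀ p, x p = √(m : ℝ) • (Φ p : EuclideanSpace ℝ (Fin (m + 1)))) := by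
  have hnorm := hx.norm_eq_sqrt hbdd hH hsup
  have hr : 0 < √(m : ℝ) := Real.sqrt_pos.2 (by exact_mod_cast hm)
  have := Fact.mk (@finrank_euclideanSpace_fin ℝ _ (m + 1))
  have := hx.connected
  have hiso := hx.toIsIsometricImmersion
  -- The covering argument is carried out on the unit sphere, which carries the stereographic
  -- charts, and transported back by the homothety.
  set q : S → Metric.sphere (0 : EuclideanSpace ℝ (Fin (m + 1))) 1 := fun p ↦
    (Shrinker.sphereHomothety hr).symm ⟨x p, by simp [hnorm]⟩ with hqdef
  have hqx : ∀ p, Shrinker.sphereHomothety hr (q p) = ⟨x p, by simp [hnorm]⟩ := fun p ↦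
    Homeomorph.apply_symm_apply _ _
  have hq : ∀ p, x p = √(m : ℝ) • (q p : EuclideanSpace ℝ (Fin (m + 1))) := fun p ↦
    congrArg Subtype.val (hqx p).symm
  have hloc := Shrinker.isLocalHomeomorph_of_eq_smul hiso hr hq
  have hsec := Shrinker.hasSections_of_eq_smul hiso hr hq
  have hmem : ∀ y : Metric.sphere (0 : EuclideanSpace ℝ (Fin (m + 1))) 1,
      y ∈ (stereographic' m (-y)).source := fun y ↦ mem_chart_source (EuclideanSpace ℝ (Fin m)) y
  have : PreconnectedSpace (Metric.sphere (0 : EuclideanSpace ℝ (Fin (m + 1))) 1) := by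
    refine Subtype.preconnectedSpace (isPreconnected_sphere ?_ 0 1)
    rw [← Module.finrank_eq_rank, finrank_euclideanSpace_fin]
    exact_mod_cast Nat.lt_succ_of_le hm
  have hsurj : Function.Surjective q := Shrinker.surjective_of_hasSections hloc
    fun y ↦ ⟨stereographic' m (-y), hmem y, hsec _⟩
  refine ⟨hnorm, ⟨fun p ↦ Shrinker.sphereHomothety hr (q p), fun p ↦ congrArg Subtype.val (hqx p), ?_, ?_⟩, ?_⟩
  · have hcov : IsCoveringMap q := fun y ↦ Shrinker.isEvenlyCovered_of_hasSections hloc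
      (stereographic'_target _) (hsec (-y)) (hmem y) (hsurj y)
    exact hcov.homeomorph_comp (Shrinker.sphereHomothety hr)
  · exact (Shrinker.sphereHomothety hr).surjective.comp hsurj
  · intro hm2
    -- The sphere is covered by the stereographic domains of two antipodal poles; any two distinct
    -- poles would do.
    have hne : -q x₀ ≠ q x₀ := (ne_neg_of_mem_unit_sphere ℝ (q x₀)).symm
    have hconn := Shrinker.isConnected_compl_singleton_inter_compl_singleton hm2 hne
    obtain ⟨y, hy⟩ := hconn.nonempty
    obtain ⟨p, rfl⟩ := hsurj y
    rw [← stereographic'_source (n := m) (-q x₀),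
      ← stereographic'_source (n := m) (q x₀)] at hconn hy
    have hinj : Function.Injective q := Shrinker.injective_of_hasSections hloc (hsec _) (hsec _)
      (by
        rw [stereographic'_source, stereographic'_source, ← Set.compl_inter,
          (Set.disjoint_singleton.2 hne).inter_eq, Set.compl_empty]) hconn.isPreconnected hy
    obtain ⟨Φ, hΦ⟩ := Shrinker.exists_diffeomorph_of_bijective hiso hr hq ⟨hinj, hsurj⟩
    exact ⟨Φ, fun p ↦ by rw [hΦ]; exact hq p⟩
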